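/- Let $k$ be a field, let $d\ge 2$, and let $\mathcal{H}$ be a $d$-uniform hypergraph on the vertex set $[n]=\{1,\dots,n\}$, that is, a set of $d$-element subsets of $[n]$, called edges. Let $R=k[x_1,\dots,x_n]$ and $\mathfrak m=(x_1,\dots,x_n)$. Let $\Delta(\mathcal{H})$ be the clique complex, consisting of all $F\subseteq[n]$ such that every $d$-element subset of $F$ is an edge, and let $I=I_{\Delta(\mathcal{H})}\subseteq R$ be its Stanley--Reisner ideal, generated by the monomials $\prod_{i\in F}x_i$ with $F\notin\Delta(\mathcal{H})$. Define the connectivity of $\mathcal{H}$ over $k$ by $$\mathrm{con}(\mathcal{H})=\min\{|V| : V\subseteq[n],\ \dim_k\tilde H_{d-2}(\Delta(\mathcal{H})_{[n]\setminus V};k)\neq 0\}$$ (with $\mathrm{con}(\mathcal{H})=\infty$ if there is no such $V$), where $\tilde H$ is reduced simplicial homology and $\Delta_W$ is the complex of all faces of $\Delta$ contained in $W$. Call $\mathcal{H}$ homologically connected over $k$ if $\mathrm{con}(\mathcal{H})\neq 0$. Put $\mathrm{pd}_R(R/I)=\max\{i:\mathrm{Tor}_i^R(R/I,k)\neq0\}$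 and $\beta_{i,j}(R/I)=\dim_k\mathrm{Tor}_i^R(R/I,k)_j$. Let $\mathrm{depth}_R(R/I)$ be the maximal length of an $R/I$-regular sequence in $\mathfrak m$. The length of the linear strand of $R/I$ is $\max\{i:\beta_{i,i+d-1}(R/I)\neq0\}$ (and $-\infty$ if no such $i$ exists); it is called maximal if it equals $\mathrm{pd}_R(R/I)$. Call $R/I$ Cohen--Macaulay if $\mathrm{depth}_R(R/I)=\dim R/I$. Then: 1. $\mathcal{H}$ is not homologically connected over $k$ if and only if $\mathrm{pd}_R(R/I)=n-d+1$, $\mathrm{depth}_R(R/I)=d-1$, and the length of the linear strand of $R/I$ is maximal. 2. If $R/I$ is Cohen--Macaulay of dimension at least $d$, then $\mathrm{con}(\mathcal{H})\neq 0$. 3. $\mathrm{con}(\mathcal{H})=0$ and $R/I$ is Cohen--Macaulay if and only if $\mathcal{H}$ has no edges and $n\ge d$. -/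

import Mathlib

open CategoryTheory Finset MvPolynomial

noncomputable section

namespace HypergraphConn

universe u

/-! ### Hypergraphs, clique complexes, Stanley-Reisner ideals -/

/-- Every edge has exactly `d` elements. For `d ≥ 2` such a hypergraph is automatically simple. -/
def IsUniform {n : ℕ} (H : Hypergraph (Fin n)) (d : ℕ) : Prop :=
  ∀ e ∈ H.edgeSet, e.ncard = d

/-- An abstract simplicial complex on the vertex set `[n]`: a family of subsets of `[n]` closed
under passing to subsets. The empty set is a face unless the complex is void, and singletons need
not be faces. -/
structure SimplicialComplex (n : ℕ) where
  faces : Set (Finset (Fin n))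
  down_closed : ∀ ⦃F G : Finset (Fin n)⦄, F ∈ faces → G ⊆ F → G ∈ faces

/-- The subcomplex `Δ_V` of all faces contained in `V`. -/
def SimplicialComplex.restrict {n : ℕ} (Δ : SimplicialComplex n) (V : Finset (Fin n)) :
    SimplicialComplex n where
  faces := {F | F ∈ Δ.faces ∧ F ⊆ V}
  down_closed _ _ hF hG := ⟨Δ.down_closed hF.1 hG, hG.trans hF.2⟩

/-- The clique complex `Δ(H)` of a `d`-uniform hypergraph: the sets all of whose `d`-element
subsets are edges. -/
def cliqueComplex {n : ℕ} (H : Hypergraph (Fin n)) (d : ℕ) : SimplicialComplex n where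
  faces := {F | ∀ E ⊆ F, E.card = d → (E : Set (Fin n)) ∈ H.edgeSet}
  down_closed _ _ hF hG E hE hc := hF E (hE.trans hG) hc

/-- The Stanley-Reisner ideal, generated by the monomials `x^F` of the nonfaces `F`. -/
def stanleyReisnerIdeal (k : Type u) [Field k] {n : ℕ} (Δ : SimplicialComplex n) :
    Ideal (MvPolynomial (Fin n) k) :=
  Ideal.span {p | ∃ F : Finset (Fin n), F ∉ Δ.faces ∧ p = ∏ i ∈ F, X i}

/-- The ring `R / I_{Δ(H)}`, where `R = k[x_1, …, x_n]`. -/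
abbrev cliqueRing (k : Type u) [Field k] {n : ℕ} (H : Hypergraph (Fin n)) (d : ℕ) : Type u :=
  MvPolynomial (Fin n) k ⧸ stanleyReisnerIdeal k (cliqueComplex H d)

/-! ### Exterior differentials

A chain `∑_S f(S) e_S` over all subsets `S` of `[n]`, with coefficients in an `R`-module `M`, is
stored as its coefficient function `f`. -/

/-- The sign of `v` relative to `T`, that is `(-1)` to the number of elements of `T` below `v`. -/
def koszulSign {n : ℕ} (v : Fin n) (T : Finset (Fin n)) : ℤ :=
  (-1) ^ (T.filter (· < v)).card

/-- For scalars `a_1, …, a_n`, the differential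
`m e_S ↦ ∑_{v ∈ S} (-1)^{#{w ∈ S : w < v}} a_v m e_{S \ v}`. With all `a_v = 1` this is the
simplicial boundary map, with `a_v = x_v` it is the Koszul differential. -/
def differential {n : ℕ} {R : Type*} (M : Type*) [CommRing R] [AddCommGroup M] [Module R M]
    (a : Fin n → R) : (Finset (Fin n) → M) →ₗ[R] (Finset (Fin n) → M) where
  toFun f T := ∑ v ∈ Tᶜ, koszulSign v T • a v • f (insert v T)
  map_add' f g := by
    ext T
    simp [Finset.sum_add_distrib]
  map_smul' r f := by
    ext T
    simp only [Pi.smul_apply, RingHom.id_apply, Finset.smul_sum]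
    refine Finset.sum_congr rfl fun v _ => ?_
    rw [smul_comm (a v) r, smul_comm (koszulSign v T) r]

/-- The value of the differential on a basis chain `m e_S`. -/
theorem differential_single {n : ℕ} {R : Type*} (M : Type*) [CommRing R] [AddCommGroup M]
    [Module R M] (a : Fin n → R) (S : Finset (Fin n)) (m : M) :
    differential M a (Pi.single S m) =
      ∑ v ∈ S, koszulSign v S • a v • Pi.single (S.erase v) m := by
  ext T
  simp only [differential, LinearMap.coe_mk, AddHom.coe_mk, Finset.sum_apply, Pi.smul_apply,
    Pi.single_apply]
  rw [← Finset.sum_filter_add_sum_filter_not Tᶜ (fun v => insert v T = S),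
    ← Finset.sum_filter_add_sum_filter_not S (fun v => T = S.erase v)]
  have hset : Tᶜ.filter (fun v => insert v T = S) = S.filter (fun v => T = S.erase v) := by
    ext v
    simp only [Finset.mem_filter, Finset.mem_compl]
    constructor
    · rintro ⟨hv, rfl⟩
      exact ⟨Finset.mem_insert_self _ _, (Finset.erase_insert hv).symm⟩
    · rintro ⟨hv, rfl⟩
      exact ⟨Finset.notMem_erase _ _, Finset.insert_erase hv⟩
  congr 1
  · rw [hset]
    refine Finset.sum_congr rfl fun v hv => ?_
    obtain ⟨hvm, rfl⟩ := Finset.mem_filter.1 hv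
    have hvS : v ∈ S := by assumption
    have h1 : insert v (S.erase v) = S := Finset.insert_erase hvS
    rw [if_pos h1, if_pos rfl]
    simp [koszulSign, Finset.filter_erase]
  · rw [Finset.sum_eq_zero, Finset.sum_eq_zero]
    · intro v hv
      simp [(Finset.mem_filter.1 hv).2]
    · intro v hv
      simp [(Finset.mem_filter.1 hv).2]

/-- The differential squares to zero. -/
theorem differential_differential {n : ℕ} {R : Type*} (M : Type*) [CommRing R] [AddCommGroup M]
    [Module R M] (a : Fin n → R) (f : Finset (Fin n) → M) :
    differential M a (differential M a f) = 0 := by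
  ext T
  simp only [differential, LinearMap.coe_mk, AddHom.coe_mk, Pi.zero_apply, Finset.smul_sum]
  rw [Finset.sum_sigma']
  have sgn : ∀ v w : Fin n, v ∉ T → w ∉ T → v < w →
      koszulSign v T * koszulSign w (insert v T) +
        koszulSign w T * koszulSign v (insert w T) = 0 := by
    intro v w hv hw h
    have h1 : koszulSign w (insert v T) = -koszulSign w T := by
      simp [koszulSign, Finset.filter_insert, h, hv, pow_succ]
    have h2 : koszulSign v (insert w T) = koszulSign v T := by
      simp [koszulSign, Finset.filter_insert, h.le.not_gt]
    rw [h1, h2]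
    ring
  have sgn' : ∀ v w : Fin n, v ∉ T → w ∉ T → v ≠ w →
      koszulSign v T * koszulSign w (insert v T) +
        koszulSign w T * koszulSign v (insert w T) = 0 := by
    intro v w hv hw h
    rcases lt_or_gt_of_ne h with h | h
    · exact sgn v w hv hw h
    · rw [add_comm]
      exact sgn w v hw hv h
  refine Finset.sum_involution (fun p _ => ⟨p.2, p.1⟩) ?_ ?_ ?_ ?_
  · rintro ⟨v, w⟩ hp
    simp only [Finset.mem_sigma, Finset.mem_compl, Finset.mem_insert, not_or] at hp
    have := sgn' v w hp.1 hp.2.2 (Ne.symm hp.2.1)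
    dsimp only
    rw [Finset.insert_comm w v, smul_comm (a v) (koszulSign w (insert v T)),
      smul_comm (a w) (koszulSign v (insert w T)), smul_comm (a w) (a v),
      smul_smul (koszulSign v T), smul_smul (koszulSign w T), ← add_smul, this, zero_smul]
  · rintro ⟨v, w⟩ hp _ h
    simp only [Finset.mem_sigma, Finset.mem_compl, Finset.mem_insert, not_or] at hp
    simp only [Sigma.mk.injEq] at h
    exact hp.2.1 h.1
  · rintro ⟨v, w⟩ hp
    simp only [Finset.mem_sigma, Finset.mem_compl, Finset.mem_insert, not_or] at hp ⊢
    exact ⟨hp.2.2, Ne.symm hp.2.1, hp.1⟩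
  · rintro ⟨v, w⟩ _
    rfl

/-- Exactness of the Koszul complex of `x_1, …, x_n` over `R = k[x_1, …, x_n]` in positive
homological degrees; as its cokernel in degree `0` is `R / (x_1, …, x_n)`, it is a free resolution
of the residue field. -/
theorem koszul_exact (k : Type u) [Field k] {n : ℕ} (i : ℕ)
    (f : Finset (Fin n) → MvPolynomial (Fin n) k) (hf : ∀ S, S.card ≠ i + 1 → f S = 0)
    (hd : differential _ (X : Fin n → MvPolynomial (Fin n) k) f = 0) :
    ∃ g : Finset (Fin n) → MvPolynomial (Fin n) k, (∀ S, S.card ≠ i + 2 → g S = 0) ∧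
      differential _ (X : Fin n → MvPolynomial (Fin n) k) g = f := by
  classical
  let g : Finset (Fin n) → MvPolynomial (Fin n) k := fun S =>
    if hS : S.Nonempty then
      ∑ b ∈ (f (S.erase (S.min' hS))).support.filter
          (fun b => S.min' hS ∈ b.support ∧ ∀ w ∈ b.support, S.min' hS ≤ w),
        monomial (b - Finsupp.single (S.min' hS) 1) (coeff b (f (S.erase (S.min' hS))))
    else 0
  have hg : ∀ (S : Finset (Fin n)) (v : Fin n) (c : Fin n →₀ ℕ), v ∈ S → (∀ w ∈ S, v ≤ w) →
      coeff c (g S) = if ∀ w ∈ c.support, v ≤ w then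
        coeff (c + Finsupp.single v 1) (f (S.erase v)) else 0 := by
    intro S v c hv hmin
    have hS : S.Nonempty := ⟨v, hv⟩
    have hm : S.min' hS = v := le_antisymm (S.min'_le v hv) (hmin _ (S.min'_mem hS))
    simp only [g, dif_pos hS, hm, coeff_sum, coeff_monomial]
    have hsupp : ∀ w, w ∈ (c + Finsupp.single v 1).support ↔ w ∈ c.support ∨ w = v := by
      intro w
      simp only [Finsupp.mem_support_iff, Finsupp.add_apply, Finsupp.single_apply]
      by_cases h : v = w
      · subst h; simp
      · simp [h, Ne.symm h]
    have hb : ∀ b : Fin n →₀ ℕ, v ∈ b.support →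
        (b - Finsupp.single v 1 = c ↔ b = c + Finsupp.single v 1) := by
      intro b hvb
      have : Finsupp.single v 1 ≤ b := by
        rw [Finsupp.single_le_iff]
        exact Nat.one_le_iff_ne_zero.2 (Finsupp.mem_support_iff.1 hvb)
      exact tsub_eq_iff_eq_add_of_le this
    by_cases hc : ∀ w ∈ c.support, v ≤ w
    · rw [if_pos hc]
      by_cases h0 : coeff (c + Finsupp.single v 1) (f (S.erase v)) = 0
      · rw [h0]
        refine Finset.sum_eq_zero fun b hbm => ?_
        obtain ⟨_, hvb, _⟩ := Finset.mem_filter.1 hbm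
        split_ifs with h
        · rw [(hb b hvb).1 h, h0]
        · rfl
      · rw [Finset.sum_eq_single (c + Finsupp.single v 1)]
        · simp
        · intro b hbm hne
          obtain ⟨_, hvb, _⟩ := Finset.mem_filter.1 hbm
          rw [if_neg fun h => hne ((hb b hvb).1 h)]
        · intro hnot
          exact absurd (Finset.mem_filter.2 ⟨mem_support_iff.2 h0, (hsupp v).2 (Or.inr rfl),
            fun w hw => ((hsupp w).1 hw).elim (hc w) fun h => h.ge⟩) hnot
    · rw [if_neg hc]
      refine Finset.sum_eq_zero fun b hbm => ?_
      obtain ⟨_, hvb, hbw⟩ := Finset.mem_filter.1 hbm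
      rw [if_neg]
      intro h
      refine hc fun w hw => hbw w ?_
      rw [(hb b hvb).1 h]
      exact (hsupp w).2 (Or.inl hw)
  have hgcard : ∀ S : Finset (Fin n), S.card ≠ i + 2 → g S = 0 := by
    intro S hS
    by_cases hne : S.Nonempty
    · have : f (S.erase (S.min' hne)) = 0 := by
        apply hf
        rw [Finset.card_erase_of_mem (S.min'_mem hne)]
        omega
      simp [g, dif_pos hne, this]
    · simp [g, dif_neg hne]
  refine ⟨g, hgcard, ?_⟩
  have hD : ∀ (h : Finset (Fin n) → MvPolynomial (Fin n) k) (S : Finset (Fin n))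
      (b : Fin n →₀ ℕ), coeff b (differential _ (X : Fin n → MvPolynomial (Fin n) k) h S) =
        ∑ v ∈ Sᶜ, koszulSign v S • if v ∈ b.support then
          coeff (b - Finsupp.single v 1) (h (insert v S)) else 0 := by
    intro h S b
    simp only [differential, LinearMap.coe_mk, AddHom.coe_mk, coeff_sum, smul_eq_mul]
    refine Finset.sum_congr rfl fun v _ => ?_
    rw [← coeff_X_mul', ← coeffAddMonoidHom_apply, ← coeffAddMonoidHom_apply, map_zsmul]
  funext S
  by_cases hS : S.card = i + 1
  swap
  · rw [hf S hS]
    simp only [differential, LinearMap.coe_mk, AddHom.coe_mk]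
    refine Finset.sum_eq_zero fun v hv => ?_
    rw [hgcard (insert v S), smul_zero, smul_zero]
    rw [Finset.card_insert_of_notMem (Finset.mem_compl.1 hv)]
    omega
  have hne : S.Nonempty := by
    rw [← Finset.card_pos]
    omega
  ext b
  rw [hD]
  obtain ⟨u, huS, humin⟩ : ∃ u ∈ S, ∀ w ∈ S, u ≤ w :=
    ⟨S.min' hne, S.min'_mem hne, fun w hw => S.min'_le w hw⟩
  by_cases hb : ∀ w ∈ b.support, u ≤ w
  · have h0 : coeff (b + Finsupp.single u 1)
        (differential _ (X : Fin n → MvPolynomial (Fin n) k) f (S.erase u)) = 0 := by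
      rw [hd]
      simp
    have hcompl : (S.erase u)ᶜ = insert u Sᶜ := by
      ext w
      by_cases h : w = u <;> simp [h]
    rw [hD, hcompl, Finset.sum_insert (by simpa using huS), Finset.insert_erase huS] at h0
    have hu : koszulSign u (S.erase u) = 1 := by
      have : (S.erase u).filter (· < u) = ∅ := by
        ext w
        simp only [Finset.mem_filter, Finset.mem_erase, Finset.notMem_empty, iff_false, not_and,
          not_lt]
        exact fun hw => humin w hw.2
      simp [koszulSign, this]
    rw [hu, if_pos (by simp), add_tsub_cancel_right, one_smul] at h0
    rw [eq_neg_of_add_eq_zero_left h0, ← Finset.sum_neg_distrib]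
    refine Finset.sum_congr rfl fun v hv => ?_
    have hvS : v ∉ S := Finset.mem_compl.1 hv
    have hvu : v ≠ u := fun h => hvS (h ▸ huS)
    by_cases hvb : v ∈ b.support
    · have huv : u < v := lt_of_le_of_ne (hb v hvb) (Ne.symm hvu)
      have hle : Finsupp.single v 1 ≤ b := by
        rw [Finsupp.single_le_iff]
        exact Nat.one_le_iff_ne_zero.2 (Finsupp.mem_support_iff.1 hvb)
      have hs : koszulSign v S = -koszulSign v (S.erase u) := by
        conv_lhs => rw [← Finset.insert_erase huS]
        simp only [koszulSign, Finset.filter_insert, huv, if_true]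
        rw [Finset.card_insert_of_notMem (by simp), pow_succ]
        ring
      have hvb' : v ∈ (b + Finsupp.single u 1).support := by
        rw [Finsupp.mem_support_iff] at hvb ⊢
        simp only [Finsupp.add_apply]
        omega
      rw [if_pos hvb, if_pos hvb', hg (insert v S) u _ (Finset.mem_insert_of_mem huS)
        (fun w hw => (Finset.mem_insert.1 hw).elim (fun h => h ▸ huv.le) (humin w)), if_pos, hs,
        Finset.erase_insert_of_ne hvu, neg_smul, tsub_add_eq_add_tsub hle]
      intro w hw
      apply hb
      rw [Finsupp.mem_support_iff] at hw ⊢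
      intro h
      apply hw
      simp [h]
    · have hvb' : v ∉ (b + Finsupp.single u 1).support := by
        rw [Finsupp.notMem_support_iff] at hvb ⊢
        simp [hvb, Ne.symm hvu]
      rw [if_neg hvb, if_neg hvb', smul_zero, smul_zero, neg_zero]
  · have hbne : b.support.Nonempty := by
      by_contra h
      rw [Finset.not_nonempty_iff_eq_empty] at h
      exact hb (by simp [h])
    obtain ⟨m, hmb, hmmin⟩ : ∃ m ∈ b.support, ∀ w ∈ b.support, m ≤ w :=
      ⟨b.support.min' hbne, b.support.min'_mem hbne, fun w hw => b.support.min'_le w hw⟩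
    have hmu : m < u := by
      push Not at hb
      obtain ⟨w, hw, hwu⟩ := hb
      exact lt_of_le_of_lt (hmmin w hw) hwu
    have hmS : m ∉ S := fun h => absurd (humin m h) (not_le.2 hmu)
    have hmle : Finsupp.single m 1 ≤ b := by
      rw [Finsupp.single_le_iff]
      exact Nat.one_le_iff_ne_zero.2 (Finsupp.mem_support_iff.1 hmb)
    rw [Finset.sum_eq_single m]
    · have hs : koszulSign m S = 1 := by
        have : S.filter (· < m) = ∅ := by
          ext w
          simp only [Finset.mem_filter, Finset.notMem_empty, iff_false, not_and, not_lt]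
          exact fun hw => hmu.le.trans (humin w hw)
        simp [koszulSign, this]
      rw [if_pos hmb, hg (insert m S) m _ (Finset.mem_insert_self _ _)
        (fun w hw => (Finset.mem_insert.1 hw).elim (fun h => h.ge)
          fun h => hmu.le.trans (humin w h)), if_pos, hs, one_smul, Finset.erase_insert hmS,
        tsub_add_cancel_of_le hmle]
      intro w hw
      apply hmmin
      rw [Finsupp.mem_support_iff] at hw ⊢
      intro h
      apply hw
      simp [h]
    · intro v hv hvm
      have hvS : v ∉ S := Finset.mem_compl.1 hv
      by_cases hvb : v ∈ b.support
      swap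
      · rw [if_neg hvb, smul_zero]
      obtain ⟨t, ht, htmin⟩ : ∃ t ∈ insert v S, ∀ w ∈ insert v S, t ≤ w :=
        ⟨(insert v S).min' ⟨v, Finset.mem_insert_self _ _⟩, Finset.min'_mem _ _,
          fun w hw => Finset.min'_le _ w hw⟩
      have hmt : m < t := by
        rcases Finset.mem_insert.1 ht with h | h
        · rw [h]
          exact lt_of_le_of_ne (hmmin v hvb) (Ne.symm hvm)
        · exact hmu.trans_le (humin t h)
      rw [if_pos hvb, hg (insert v S) t _ ht htmin, if_neg, smul_zero]
      intro h
      refine absurd (h m ?_) (not_le.2 hmt)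
      rw [Finsupp.mem_support_iff] at hmb ⊢
      simpa [Finsupp.single_apply, hvm] using hmb
    · intro h
      exact absurd (Finset.mem_compl.2 hmS) h

/-! ### Reduced homology and connectivity -/

/-- Reduced `i`-chains of `Δ` over `k`: chains supported on the faces of dimension `i`, that is,
of cardinality `i + 1`. The empty face, if present, spans the `(-1)`-chains. -/
def chains (k : Type u) [Field k] {n : ℕ} (Δ : SimplicialComplex n) (i : ℤ) :
    Submodule k (Finset (Fin n) → k) where
  carrier := {f | ∀ F, ¬ (F ∈ Δ.faces ∧ (F.card : ℤ) = i + 1) → f F = 0}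
  zero_mem' _ _ := rfl
  add_mem' hf hg F hF := by simp [hf F hF, hg F hF]
  smul_mem' c f hf F hF := by simp [hf F hF]

/-- The simplicial boundary map. -/
def boundary (k : Type u) [Field k] (n : ℕ) : (Finset (Fin n) → k) →ₗ[k] (Finset (Fin n) → k) :=
  differential k (fun _ => (1 : k))

/-- Reduced homology `H̃_i(Δ; k)`, cycles modulo boundaries. -/
abbrev reducedHomology (k : Type u) [Field k] {n : ℕ} (Δ : SimplicialComplex n) (i : ℤ) : Type u :=
  ↥(chains k Δ i ⊓ LinearMap.ker (boundary k n)) ⧸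
    ((chains k Δ (i + 1)).map (boundary k n)).submoduleOf
      (chains k Δ i ⊓ LinearMap.ker (boundary k n))

/-- The connectivity of a `d`-uniform hypergraph over `k`: the least cardinality of a set `V` of
vertices such that `H̃_{d-2}` of `Δ(H)` restricted to `[n] \ V` is nonzero (`⊤` if there is none). -/
def connectivity (k : Type u) [Field k] {n : ℕ} (H : Hypergraph (Fin n)) (d : ℕ) : ℕ∞ :=
  ⨅ V ∈ {V : Finset (Fin n) |
    Module.finrank k (reducedHomology k ((cliqueComplex H d).restrict Vᶜ) ((d : ℤ) - 2)) ≠ 0},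
    (V.card : ℕ∞)

/-- A hypergraph is homologically connected over `k` if its connectivity over `k` is nonzero. -/
def HomologicallyConnected (k : Type u) [Field k] {n : ℕ} (H : Hypergraph (Fin n)) (d : ℕ) :
    Prop :=
  connectivity k H d ≠ 0

/-! ### Projective dimension, depth, Cohen-Macaulay rings -/

/-- The ideal `(x_1, …, x_n)`. -/
def irrelevantIdeal (k : Type u) [Field k] (n : ℕ) : Ideal (MvPolynomial (Fin n) k) :=
  Ideal.span (Set.range X)

/-- `Tor_i^R(M, k)`, where `k = R / (x_1, …, x_n)`. -/
def residueTor (k : Type u) [Field k] (n : ℕ) (M : Type u) [AddCommGroup M]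
    [Module (MvPolynomial (Fin n) k) M] (i : ℕ) : ModuleCat.{u} (MvPolynomial (Fin n) k) :=
  ((Tor (ModuleCat.{u} (MvPolynomial (Fin n) k)) i).obj
    (ModuleCat.of (MvPolynomial (Fin n) k) M)).obj
      (ModuleCat.of (MvPolynomial (Fin n) k) (MvPolynomial (Fin n) k ⧸ irrelevantIdeal k n))

/-- `pd_R(M) = max {i : Tor_i^R(M, k) ≠ 0}`, with value `⊥` if there is no such `i` and `⊤` if
there are arbitrarily large ones. -/
def projDim (k : Type u) [Field k] (n : ℕ) (M : Type u) [AddCommGroup M]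
    [Module (MvPolynomial (Fin n) k) M] : WithBot ℕ∞ :=
  ⨆ i ∈ {i : ℕ | ¬ Limits.IsZero (residueTor k n M i)}, (i : WithBot ℕ∞)

/-- `depth_R(M)`: the supremum of the lengths of `M`-regular sequences in `(x_1, …, x_n)`. -/
def depth (k : Type u) [Field k] (n : ℕ) (M : Type u) [AddCommGroup M]
    [Module (MvPolynomial (Fin n) k) M] : ℕ∞ :=
  ⨆ rs ∈ {rs : List (MvPolynomial (Fin n) k) |
    (∀ r ∈ rs, r ∈ irrelevantIdeal k n) ∧ RingTheory.Sequence.IsRegular M rs}, (rs.length : ℕ∞)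

/-- A Stanley-Reisner ring `R / I` is Cohen-Macaulay if its depth equals its Krull dimension. -/
def IsCohenMacaulay {k : Type u} [Field k] {n : ℕ} (I : Ideal (MvPolynomial (Fin n) k)) : Prop :=
  (depth k n (MvPolynomial (Fin n) k ⧸ I) : WithBot ℕ∞) =
    ringKrullDim (MvPolynomial (Fin n) k ⧸ I)

/-! ### Graded Tor and the linear strand

`Tor_i^R(R/I, k)` for a homogeneous ideal `I` inherits a grading from any graded free resolution
of `k`. The one used here is the Koszul complex (see `koszul_exact`), in which `e_S` has
homological degree and internal degree `#S`. -/

/-- The component of degree `m` of `R / I`. -/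
def quotientPiece {k : Type u} [Field k] {n : ℕ} (I : Ideal (MvPolynomial (Fin n) k)) (m : ℕ) :
    Submodule k (MvPolynomial (Fin n) k ⧸ I) :=
  (homogeneousSubmodule (Fin n) k m).map (Ideal.Quotient.mkₐ k I).toLinearMap

/-- The degree `j` part of the `i`-th term `⨁_{#S = i} (R/I) e_S` of the Koszul resolution of `k`
tensored with `R/I`: coefficients of `e_S` must have degree `j - i`. -/
def koszulChains {k : Type u} [Field k] {n : ℕ} (I : Ideal (MvPolynomial (Fin n) k)) (i j : ℕ) :
    Submodule k (Finset (Fin n) → MvPolynomial (Fin n) k ⧸ I) where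
  carrier := {f | ∀ S : Finset (Fin n),
    (S.card = i ∧ i ≤ j → f S ∈ quotientPiece I (j - i)) ∧ (¬ (S.card = i ∧ i ≤ j) → f S = 0)}
  zero_mem' _ := ⟨fun _ => Submodule.zero_mem _, fun _ => rfl⟩
  add_mem' {f g} hf hg S := by
    refine ⟨fun h => ?_, fun h => ?_⟩
    · exact Submodule.add_mem _ ((hf S).1 h) ((hg S).1 h)
    · rw [Pi.add_apply, (hf S).2 h, (hg S).2 h, add_zero]
  smul_mem' c f hf S := by
    refine ⟨fun h => ?_, fun h => ?_⟩
    · exact Submodule.smul_mem _ c ((hf S).1 h)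
    · rw [Pi.smul_apply, (hf S).2 h, smul_zero]

/-- The differential of the Koszul resolution tensored with `R/I`, as a `k`-linear map. -/
def koszulDifferential {k : Type u} [Field k] {n : ℕ} (I : Ideal (MvPolynomial (Fin n) k)) :
    (Finset (Fin n) → MvPolynomial (Fin n) k ⧸ I) →ₗ[k]
      (Finset (Fin n) → MvPolynomial (Fin n) k ⧸ I) :=
  (differential (MvPolynomial (Fin n) k ⧸ I) (X : Fin n → MvPolynomial (Fin n) k)).restrictScalars k

/-- `Tor_i^R(R/I, k)_j`. -/
abbrev gradedTor {k : Type u} [Field k] {n : ℕ} (I : Ideal (MvPolynomial (Fin n) k)) (i j : ℕ) :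
    Type u :=
  ↥(koszulChains I i j ⊓ LinearMap.ker (koszulDifferential I)) ⧸
    ((koszulChains I (i + 1) j).map (koszulDifferential I)).submoduleOf
      (koszulChains I i j ⊓ LinearMap.ker (koszulDifferential I))

/-- The graded Betti number `β_{i,j}(R/I) = dim_k Tor_i^R(R/I, k)_j`. -/
def gradedBetti {k : Type u} [Field k] {n : ℕ} (I : Ideal (MvPolynomial (Fin n) k)) (i j : ℕ) : ℕ :=
  Module.finrank k (gradedTor I i j)

/-- The length of the linear strand, the part of the resolution in degrees `(i, i + d - 1)`
(here `d ≥ 1`): the largest `i` with `β_{i, i+d-1} ≠ 0`, or `⊥` if there is none. -/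
def linearStrandLength {k : Type u} [Field k] {n : ℕ} (I : Ideal (MvPolynomial (Fin n) k))
    (d : ℕ) : WithBot ℕ∞ :=
  ⨆ i ∈ {i : ℕ | gradedBetti I i (i + (d - 1)) ≠ 0}, (i : WithBot ℕ∞)

/-- The linear strand has maximal length if it is as long as the whole minimal resolution. -/
def LinearStrandMaximal {k : Type u} [Field k] {n : ℕ} (I : Ideal (MvPolynomial (Fin n) k))
    (d : ℕ) : Prop :=
  linearStrandLength I d = projDim k n (MvPolynomial (Fin n) k ⧸ I)

end HypergraphConn

end

/-!
The proof rests on Koszul homology. With `R = k[x_1, …, x_n]` and `I` the Stanley-Reisner ideal of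
the clique complex `Δ`, the Koszul complex of the variables with coefficients in `R/I` computes
`Tor(R/I, k)` (`isZero_residueTor_iff`), its graded version defines the graded Betti numbers, and
it governs depth.

*Hochster's formula.* The complex is graded by exponents `a`, and in multidegree `a` it is a
complex of `k`-valued functions on subsets of the support of `a` with the simplicial boundary map
(`MultigradedExact`). If some `a_v ≥ 2`, multiplication by the basis vector `e_v` is a contracting
homotopy (`multigradedExact_of_two_le`). In multidegree `(1, …, 1)`, passing to complements
identifies the complex with the reduced cochains of `Δ`, so its homology in degree `n - p` is dual
to the reduced homology of `Δ` spanned by faces with `p` elements (`multigradedExact_univ_iff`).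

*Vanishing.* Every set with fewer than `d` vertices is a face of `Δ`. This makes the same homotopy
work in homological degrees above `n - d + 1` in every multidegree
(`multigradedExact_of_skeleton`), so there `Tor(R/I, k)` vanishes.

*Depth.* Dividing by a regular element of `(x_1, …, x_n)` raises the top nonvanishing degree of
Koszul homology by one. If that degree is `i`, the depth is therefore `n - i`: regular sequences
cannot be longer (`length_add_le_of_not_koszulExactAt`), and as long as the top Koszul homology,
which is the socle, vanishes, prime avoidance yields another regular element
(`exists_isRegular_of_koszulExactAt`).

Hence, if `H` is not homologically connected, `Tor_{n-d+1}(R/I, k)` is the last nonzero Tor, it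
lies on the linear strand, and the depth is `d - 1`. Conversely, a linear strand of length `n - d
+ 1` ends in total degree `n`, where only the multidegree `(1, …, 1)` contributes, so it detects
the reduced homology of `Δ` in dimension `d - 2`. The statements on Cohen-Macaulay rings follow
because the Krull dimension of `R/I` is at least the cardinality of any face
(`card_le_ringKrullDim`), hence at least `d` when there is an edge, and is at most the largest
such cardinality (`ringKrullDim_le_of_card_le`).
-/

noncomputable section

namespace HypergraphConn

universe u

/-! ### Signs and the cone operator -/

theorem koszulSign_mul_self {n : ℕ} (v : Fin n) (T : Finset (Fin n)) :
    koszulSign v T * koszulSign v T = 1 := by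
  rw [koszulSign, ← mul_pow]
  simp

theorem koszulSign_insert {n : ℕ} {v : Fin n} (w : Fin n) {T : Finset (Fin n)} (hv : v ∉ T) :
    koszulSign w (insert v T) = (if v < w then -1 else 1) * koszulSign w T := by
  by_cases h : v < w
  · simp [koszulSign, Finset.filter_insert, h, hv, pow_succ]
  · simp [koszulSign, Finset.filter_insert, h]

theorem koszulSign_insert_self {n : ℕ} (v : Fin n) (T : Finset (Fin n)) :
    koszulSign v (insert v T) = koszulSign v T := by
  simp [koszulSign, Finset.filter_insert]

theorem koszulSign_erase_self {n : ℕ} (v : Fin n) (T : Finset (Fin n)) :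
    koszulSign v (T.erase v) = koszulSign v T := by
  simp [koszulSign, Finset.filter_erase]

section Differential

open scoped Pointwise

variable {n : ℕ} {R M M' : Type*} [CommRing R] [AddCommGroup M] [Module R M]
  [AddCommGroup M'] [Module R M']

theorem differential_apply (a : Fin n → R) (f : Finset (Fin n) → M) (T : Finset (Fin n)) :
    differential M a f T = ∑ v ∈ Tᶜ, koszulSign v T • a v • f (insert v T) :=
  rfl

/-- The differential is natural in the coefficient module. -/
theorem differential_map (a : Fin n → R) (φ : M →ₗ[R] M') (f : Finset (Fin n) → M) :
    differential M' a (fun S => φ (f S)) = fun S => φ (differential M a f S) := by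
  funext T
  simp [differential_apply, map_sum]

/-- The differential lowers the homological degree by one. -/
theorem differential_card (a : Fin n → R) {f : Finset (Fin n) → M} {i : ℕ}
    (hf : ∀ S, S.card ≠ i + 1 → f S = 0) (T : Finset (Fin n)) (hT : T.card ≠ i) :
    differential M a f T = 0 := by
  rw [differential_apply]
  refine Finset.sum_eq_zero fun v hv => ?_
  rw [hf, smul_zero, smul_zero]
  rw [Finset.card_insert_of_notMem (Finset.mem_compl.1 hv)]
  omega

theorem differential_card_zero (a : Fin n → R) {f : Finset (Fin n) → M}
    (hf : ∀ S, S.card ≠ 0 → f S = 0) : differential M a f = 0 := by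
  funext T
  rw [differential_apply]
  refine Finset.sum_eq_zero fun v hv => ?_
  rw [hf, smul_zero, smul_zero]
  rw [Finset.card_insert_of_notMem (Finset.mem_compl.1 hv)]
  omega

/-- Exterior multiplication `m e_S ↦ ± m e_{S ∪ v}` by the basis vector `e_v`. -/
def cone (v : Fin n) (f : Finset (Fin n) → M) : Finset (Fin n) → M :=
  fun S => if v ∈ S then koszulSign v S • f (S.erase v) else 0

theorem cone_card (v : Fin n) {f : Finset (Fin n) → M} {i : ℕ}
    (hf : ∀ S, S.card ≠ i → f S = 0) (S : Finset (Fin n)) (hS : S.card ≠ i + 1) :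
    cone v f S = 0 := by
  unfold cone
  split_ifs with h
  · rw [hf, smul_zero]
    have := Finset.card_erase_add_one h
    omega
  · rfl

theorem cone_zero (v : Fin n) : cone v (0 : Finset (Fin n) → M) = 0 := by
  funext S
  simp [cone]

/-- Exterior multiplication by `e_v` is a homotopy between `0` and multiplication by `a_v`. -/
theorem differential_cone_add (a : Fin n → R) (v : Fin n) (f : Finset (Fin n) → M) :
    differential M a (cone v f) + cone v (differential M a f) = a v • f := by
  funext T
  simp only [Pi.add_apply, Pi.smul_apply]
  by_cases hv : v ∈ T
  · have hcompl : (T.erase v)ᶜ = insert v Tᶜ := by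
      ext w
      by_cases h : w = v <;> simp [h]
    rw [cone, if_pos hv, differential_apply, differential_apply, hcompl,
      Finset.sum_insert (by simpa using hv), Finset.insert_erase hv, koszulSign_erase_self,
      smul_add, smul_smul, koszulSign_mul_self, one_smul, add_left_comm, Finset.smul_sum,
      ← Finset.sum_add_distrib, Finset.sum_eq_zero, add_zero]
    intro w hw
    have hwT : w ∉ T := Finset.mem_compl.1 hw
    have hwv : w ≠ v := fun h => hwT (h ▸ hv)
    rw [cone, if_pos (Finset.mem_insert_of_mem hv), Finset.erase_insert_of_ne hwv,
      smul_comm (a w), smul_smul, smul_smul, ← add_smul]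
    have h0 : koszulSign w T = (if v < w then -1 else 1) * koszulSign w (T.erase v) := by
      rw [← koszulSign_insert w (Finset.notMem_erase v T), Finset.insert_erase hv]
    have h1 : koszulSign w T * koszulSign v (insert w T) +
        koszulSign v T * koszulSign w (T.erase v) = 0 := by
      rw [koszulSign_insert v hwT, h0]
      rcases lt_or_gt_of_ne hwv with h | h
      · simp [h, h.not_gt]; ring
      · simp [h, h.not_gt]; ring
    rw [h1, zero_smul]
  · rw [differential_apply, Finset.sum_eq_single v]
    · simp only [cone, hv, if_false, add_zero, Finset.mem_insert_self, if_true]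
      rw [Finset.erase_insert hv, koszulSign_insert_self, smul_comm (a v), smul_smul,
        koszulSign_mul_self, one_smul]
    · intro w hw hwv
      rw [cone, if_neg (by simp [hv, Ne.symm hwv]), smul_zero, smul_zero]
    · intro h
      exact absurd (Finset.mem_compl.2 hv) h

/-! ### Koszul homology and regular sequences -/

/-- Exactness in homological degree `i` of the Koszul complex `⨁_S M e_S` of the scalars
`a_1, …, a_n` on the module `M`. -/
def KoszulExactAt (M : Type*) [AddCommGroup M] [Module R M] (a : Fin n → R) (i : ℕ) : Prop :=
  ∀ f : Finset (Fin n) → M, (∀ S, S.card ≠ i → f S = 0) → differential M a f = 0 →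
    ∃ g : Finset (Fin n) → M, (∀ S, S.card ≠ i + 1 → g S = 0) ∧ differential M a g = f

theorem koszulExactAt_of_lt (a : Fin n → R) {i : ℕ} (hi : n < i) : KoszulExactAt M a i := by
  intro f hf _
  refine ⟨0, fun _ _ => rfl, ?_⟩
  funext S
  rw [map_zero, hf S]
  · rfl
  · have := card_finset_fin_le S
    omega

/-- The ideal generated by `a_1, …, a_n` annihilates Koszul homology. -/
theorem exists_differential_eq_smul (a : Fin n → R) {r : R} (hr : r ∈ Ideal.span (Set.range a))
    {i : ℕ} {f : Finset (Fin n) → M} (hf : ∀ S, S.card ≠ i → f S = 0)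
    (hd : differential M a f = 0) :
    ∃ g : Finset (Fin n) → M, (∀ S, S.card ≠ i + 1 → g S = 0) ∧
      differential M a g = r • f := by
  induction hr using Submodule.span_induction with
  | mem x hx =>
    obtain ⟨v, rfl⟩ := hx
    refine ⟨cone v f, cone_card v hf, ?_⟩
    have := differential_cone_add a v f
    rwa [hd, cone_zero, add_zero] at this
  | zero => exact ⟨0, fun _ _ => rfl, by simp⟩
  | add x y _ _ hx hy =>
    obtain ⟨g, hg, hgd⟩ := hx
    obtain ⟨h, hh, hhd⟩ := hy
    exact ⟨g + h, fun S hS => by simp [hg S hS, hh S hS], by rw [map_add, hgd, hhd, add_smul]⟩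
  | smul c x _ hx =>
    obtain ⟨g, hg, hgd⟩ := hx
    exact ⟨c • g, fun S hS => by simp [hg S hS], by rw [map_smul, hgd, smul_assoc]⟩

/-- A chain on a quotient module lifts to a chain of the same homological degree. -/
theorem exists_chain_lift {φ : M →ₗ[R] M'} (hφ : Function.Surjective φ) {i : ℕ}
    {f : Finset (Fin n) → M'} (hf : ∀ S, S.card ≠ i → f S = 0) :
    ∃ g : Finset (Fin n) → M, (∀ S, S.card ≠ i → g S = 0) ∧ ∀ S, φ (g S) = f S := by
  choose s hs using hφ
  refine ⟨fun S => if S.card = i then s (f S) else 0, fun S hS => if_neg hS, fun S => ?_⟩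
  by_cases h : S.card = i
  · simp [h, hs]
  · simp [h, hf S h]

theorem exists_smul_of_mk_eq_zero {r : R} {i : ℕ} {f : Finset (Fin n) → M}
    (hf : ∀ S, S.card ≠ i → f S = 0)
    (h : ∀ S, (Submodule.mkQ (r • (⊤ : Submodule R M))) (f S) = 0) :
    ∃ u : Finset (Fin n) → M, (∀ S, S.card ≠ i → u S = 0) ∧ f = r • u := by
  have : ∀ S, ∃ x, r • x = f S := by
    intro S
    have := h S
    rw [Submodule.mkQ_apply, Submodule.Quotient.mk_eq_zero] at this
    obtain ⟨x, _, hx⟩ := (Submodule.mem_smul_pointwise_iff_exists _ _ _).1 this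
    exact ⟨x, hx⟩
  choose s hs using this
  refine ⟨fun S => if S.card = i then s S else 0, fun S hS => if_neg hS, ?_⟩
  funext S
  by_cases h : S.card = i
  · simp [h, hs]
  · simp [h, hf S h]

/-- If `r` is `M`-regular and lies in the ideal `(a_1, …, a_n)`, the connecting map
`H_{i+1}(M / rM) → H_i(M)` is onto. -/
theorem KoszulExactAt.of_quotSMulTop {a : Fin n → R} {r : R}
    (hr : r ∈ Ideal.span (Set.range a)) (hreg : IsSMulRegular M r) {i : ℕ}
    (h : KoszulExactAt (QuotSMulTop r M) a (i + 1)) : KoszulExactAt M a i := by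
  intro f hf hd
  obtain ⟨g, hg, hgd⟩ := exists_differential_eq_smul a hr hf hd
  set φ : M →ₗ[R] QuotSMulTop r M := Submodule.mkQ (r • (⊤ : Submodule R M)) with hφ
  have hφr : ∀ m : M, φ (r • m) = 0 := fun m => by
    rw [hφ, Submodule.mkQ_apply, Submodule.Quotient.mk_eq_zero]
    exact Submodule.smul_mem_pointwise_smul _ _ _ trivial
  obtain ⟨y, hy, hyd⟩ := h (fun S => φ (g S)) (fun S hS => by simp [hg S hS]) (by
    rw [differential_map, hgd]
    funext S
    exact hφr _)
  -- Lift `y` to `z`. Then `g - d z` vanishes modulo `r`, say `g - d z = r u`, and `d u = f`.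
  obtain ⟨z, hz, hzy⟩ := exists_chain_lift (φ := φ) (Submodule.mkQ_surjective _) hy
  have hyz : y = fun S => φ (z S) := funext fun S => (hzy S).symm
  rw [hyz, differential_map] at hyd
  obtain ⟨u, hu, hgu⟩ := exists_smul_of_mk_eq_zero (r := r) (i := i + 1)
    (f := g - differential M a z)
    (fun S hS => by simp [hg S hS, differential_card a hz S hS])
    (fun S => by
      have := congrFun hyd S
      simp only [Pi.sub_apply, map_sub]
      exact sub_eq_zero.2 this.symm)
  refine ⟨u, hu, ?_⟩
  have h1 : differential M a (g - differential M a z) = r • f := by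
    rw [map_sub, hgd, differential_differential, sub_zero]
  rw [hgu, map_smul] at h1
  funext S
  exact hreg (congrFun h1 S)

/-- Exactness of `H_{i+1}(M) → H_{i+1}(M / rM) → H_i(M)`. -/
theorem KoszulExactAt.quotSMulTop {a : Fin n → R} {r : R} (hreg : IsSMulRegular M r) {i : ℕ}
    (h1 : KoszulExactAt M a (i + 1)) (h0 : KoszulExactAt M a i) :
    KoszulExactAt (QuotSMulTop r M) a (i + 1) := by
  intro y hy hyd
  set φ : M →ₗ[R] QuotSMulTop r M := Submodule.mkQ (r • (⊤ : Submodule R M)) with hφ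
  have hφr : ∀ m : M, φ (r • m) = 0 := fun m => by
    rw [hφ, Submodule.mkQ_apply, Submodule.Quotient.mk_eq_zero]
    exact Submodule.smul_mem_pointwise_smul _ _ _ trivial
  -- Lift `y` to `f` and write `d f = r u`. The cycle `u` is some `d w`, and `f - r w` is a cycle
  -- that still lifts `y`.
  obtain ⟨f, hf, hfy⟩ := exists_chain_lift (φ := φ) (Submodule.mkQ_surjective _) hy
  have hyf : y = fun S => φ (f S) := funext fun S => (hfy S).symm
  rw [hyf, differential_map] at hyd
  obtain ⟨u, hu, hfu⟩ := exists_smul_of_mk_eq_zero (r := r) (f := differential M a f)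
    (differential_card a hf) (fun S => congrFun hyd S)
  have hdu : differential M a u = 0 := by
    have := differential_differential M a f
    rw [hfu, map_smul] at this
    funext S
    apply hreg
    simpa using congrFun this S
  obtain ⟨w, hw, hwu⟩ := h0 u hu hdu
  obtain ⟨g, hg, hgd⟩ := h1 (f - r • w) (fun S hS => by simp [hf S hS, hw S hS])
    (by rw [map_sub, map_smul, hwu, hfu, sub_self])
  refine ⟨fun S => φ (g S), fun S hS => by simp [hg S hS], ?_⟩
  rw [differential_map, hgd, hyf]
  funext S
  simp only [Pi.sub_apply, Pi.smul_apply]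
  rw [map_sub, hφr, sub_zero]

/-- Each term of a regular sequence in `(a_1, …, a_n)` raises the top nonvanishing degree of
Koszul homology by one. -/
theorem length_add_le_of_not_koszulExactAt {R : Type*} [CommRing R] {a : Fin n → R}
    (rs : List R) (hrs : ∀ r ∈ rs, r ∈ Ideal.span (Set.range a)) :
    ∀ {M : Type*} [AddCommGroup M] [Module R M], RingTheory.Sequence.IsRegular M rs →
      ∀ {i : ℕ}, ¬ KoszulExactAt M a i → rs.length + i ≤ n := by
  induction rs with
  | nil =>
    intro M _ _ _ i hi
    by_contra h
    exact hi (koszulExactAt_of_lt a (by simpa using h))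
  | cons r rs ih =>
    intro M _ _ hreg i hi
    rw [RingTheory.Sequence.isRegular_cons_iff] at hreg
    have := ih (fun s hs => hrs s (List.mem_cons_of_mem _ hs)) hreg.2
      (i := i + 1) fun h => hi (h.of_quotSMulTop (hrs r List.mem_cons_self) hreg.1)
    simp only [List.length_cons]
    omega

/-- The top Koszul homology of `M` is the socle `{m | a_v m = 0 for all v}`. -/
theorem KoszulExactAt.eq_zero_of_smul_eq_zero {a : Fin n → R} (h : KoszulExactAt M a n) {m : M}
    (hm : ∀ v, a v • m = 0) : m = 0 := by
  obtain ⟨g, hg, hgd⟩ := h (Pi.single Finset.univ m)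
    (fun S hS => by
      rw [Pi.single_apply, if_neg]
      rintro rfl
      simp at hS)
    (by
      rw [differential_single]
      refine Finset.sum_eq_zero fun v _ => ?_
      rw [← Pi.single_smul, hm, Pi.single_zero, smul_zero])
  have hg0 : g = 0 := by
    funext S
    apply hg
    have := card_finset_fin_le S
    omega
  have := congrFun hgd Finset.univ
  rw [hg0] at this
  simpa using this.symm

/-- The bottom Koszul homology of `M` is `M / (a_1, …, a_n) M`. -/
theorem KoszulExactAt.top_le {a : Fin n → R} (h : KoszulExactAt M a 0) :
    (⊤ : Submodule R M) ≤ Ideal.span (Set.range a) • (⊤ : Submodule R M) := by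
  intro m _
  have hc : ∀ S, S.card ≠ 0 → (Pi.single ∅ m : Finset (Fin n) → M) S = 0 := fun S hS => by
      rw [Pi.single_apply, if_neg]
      rintro rfl
      simp at hS
  obtain ⟨g, _, hgd⟩ := h (Pi.single ∅ m) hc (differential_card_zero a hc)
  have := congrFun hgd ∅
  rw [Pi.single_eq_same] at this
  rw [← this, differential_apply]
  refine Submodule.sum_mem _ fun v _ => ?_
  exact zsmul_mem (Submodule.smul_mem_smul (Ideal.subset_span (Set.mem_range_self v))
    Submodule.mem_top) _

end Differential

/-- If a maximal ideal `(a_1, …, a_n)` contains no `M`-regular element, then by prime avoidance it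
is an associated prime of `M`, so the top Koszul homology of `M` does not vanish. -/
theorem exists_isSMulRegular_of_koszulExactAt {n : ℕ} {R M : Type*} [CommRing R]
    [IsNoetherianRing R] [AddCommGroup M] [Module R M] [Module.Finite R M] {a : Fin n → R}
    (hmax : (Ideal.span (Set.range a)).IsMaximal) (h : KoszulExactAt M a n) :
    ∃ r ∈ Ideal.span (Set.range a), IsSMulRegular M r := by
  by_contra! hno
  have hsub : (Ideal.span (Set.range a) : Set R) ⊆
      ⋃ p ∈ ((associatedPrimes.finite R M).toFinset : Set (Ideal R)), p := by
    intro r hr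
    rw [Set.Finite.coe_toFinset, biUnion_associatedPrimes_eq_compl_regular]
    exact hno r hr
  obtain ⟨p, hp, hle⟩ := (Ideal.subset_union_prime (f := fun p : Ideal R => p) ⊥ ⊥
    (fun p hp _ _ => IsAssociatedPrime.isPrime ((Set.Finite.mem_toFinset _).1 hp))).1 hsub
  obtain ⟨hprime, x, hx⟩ := isAssociatedPrime_iff.1 ((Set.Finite.mem_toFinset _).1 hp)
  have hpe := hmax.eq_of_le hprime.ne_top hle
  have hx0 : x = 0 := h.eq_zero_of_smul_eq_zero fun v => by
    have : a v ∈ p := hle (Ideal.subset_span ⟨v, rfl⟩)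
    rw [hx, Submodule.mem_colon_singleton] at this
    simpa using this
  apply hprime.ne_top
  rw [hx, hx0, Ideal.eq_top_iff_one, Submodule.mem_colon_singleton]
  simp

open scoped Pointwise in
/-- If Koszul homology of `M` vanishes in the top `t` degrees, then `M` has a regular sequence of
length `t`: dividing by a regular element lowers by one the number of vanishing degrees known. -/
theorem exists_isRegular_of_koszulExactAt {n : ℕ} {R : Type*} [CommRing R] [IsNoetherianRing R]
    {a : Fin n → R} (hmax : (Ideal.span (Set.range a)).IsMaximal) (t : ℕ) :
    ∀ {M : Type*} [AddCommGroup M] [Module R M] [Module.Finite R M],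
      Ideal.span (Set.range a) • (⊤ : Submodule R M) ≠ ⊤ →
      (∀ i, n < i + t → KoszulExactAt M a i) →
      ∃ rs : List R, (∀ r ∈ rs, r ∈ Ideal.span (Set.range a)) ∧
        RingTheory.Sequence.IsRegular M rs ∧ rs.length = t := by
  induction t with
  | zero =>
    intro M _ _ _ hne _
    refine ⟨[], fun r hr => absurd hr List.not_mem_nil, ?_, rfl⟩
    have : Nontrivial M := by
      by_contra h
      rw [not_nontrivial_iff_subsingleton] at h
      exact hne (Subsingleton.elim _ _)
    exact RingTheory.Sequence.IsRegular.nil R M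
  | succ t ih =>
    intro M _ _ _ hne hex
    obtain ⟨r, hr, hreg⟩ := exists_isSMulRegular_of_koszulExactAt hmax (hex n (by omega))
    have hne' : Ideal.span (Set.range a) • (⊤ : Submodule R (QuotSMulTop r M)) ≠ ⊤ := by
      intro htop
      refine hne (top_le_iff.1 fun m _ => ?_)
      have hm : (Submodule.mkQ (r • (⊤ : Submodule R M))) m ∈
          (Ideal.span (Set.range a) • (⊤ : Submodule R M)).map (Submodule.mkQ (r • ⊤)) := by
        rw [Submodule.map_smul'', Submodule.map_top, Submodule.range_mkQ]
        exact htop.ge trivial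
      obtain ⟨x, hx, hxm⟩ := hm
      rw [Submodule.mkQ_apply, Submodule.mkQ_apply, eq_comm, Submodule.Quotient.eq] at hxm
      obtain ⟨y, hy, hyr⟩ := (Submodule.mem_smul_pointwise_iff_exists _ _ _).1 hxm
      rw [← sub_add_cancel m x, ← hyr]
      exact Submodule.add_mem _ (Submodule.smul_mem_smul hr hy) hx
    obtain ⟨rs, hrs, hrs', hlen⟩ := ih (M := QuotSMulTop r M) hne' (by
      intro i hi
      obtain _ | i := i
      -- Vanishing in all degrees down to `0` would force `M = (a_1, …, a_n) M`.
      · exact absurd (top_le_iff.1 (hex 0 (by omega)).top_le) hne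
      · exact KoszulExactAt.quotSMulTop hreg (hex _ (by omega)) (hex _ (by omega)))
    refine ⟨r :: rs, ?_, ?_, by simp [hlen]⟩
    · intro s hs
      rcases List.mem_cons.1 hs with rfl | hs
      · exact hr
      · exact hrs s hs
    · rw [RingTheory.Sequence.isRegular_cons_iff]
      exact ⟨hreg, hrs'⟩

/-! ### The Koszul resolution and Tor -/

section Graded

variable {n : ℕ} {R : Type u} {M : Type u} [CommRing R] [AddCommGroup M] [Module R M]

/-- The subsets of `[n]` with `i` elements. -/
abbrev CardSubset (n i : ℕ) : Type := {S : Finset (Fin n) // S.card = i}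

/-- Extension by zero of a family indexed by the `i`-element subsets. -/
def extendZero (R M : Type u) [CommRing R] [AddCommGroup M] [Module R M] (n i : ℕ) :
    (CardSubset n i → M) →ₗ[R] (Finset (Fin n) → M) where
  toFun f S := if h : S.card = i then f ⟨S, h⟩ else 0
  map_add' f g := by
    funext S
    by_cases h : S.card = i <;> simp [h]
  map_smul' r f := by
    funext S
    by_cases h : S.card = i <;> simp [h]

theorem extendZero_card {i : ℕ} (f : CardSubset n i → M) (S : Finset (Fin n))
    (hS : S.card ≠ i) : extendZero R M n i f S = 0 :=
  dif_neg hS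

theorem extendZero_coe {i : ℕ} (f : CardSubset n i → M) (S : CardSubset n i) :
    extendZero R M n i f S = f S :=
  dif_pos S.2

theorem extendZero_restrict {i : ℕ} {f : Finset (Fin n) → M} (hf : ∀ S, S.card ≠ i → f S = 0) :
    extendZero R M n i (fun S => f S) = f := by
  funext S
  by_cases h : S.card = i
  · exact dif_pos h
  · rw [extendZero_card _ _ h, hf S h]

theorem extendZero_injective (i : ℕ) : Function.Injective (extendZero R M n i) := by
  intro f g h
  funext S
  rw [← extendZero_coe (R := R) f S, h, extendZero_coe]

/-- The differential from chains on `(i+1)`-element subsets to chains on `i`-element subsets. -/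
def gradedDifferential (M : Type u) [AddCommGroup M] [Module R M] (a : Fin n → R) (i : ℕ) :
    (CardSubset n (i + 1) → M) →ₗ[R] (CardSubset n i → M) :=
  LinearMap.funLeft R M (Subtype.val : CardSubset n i → Finset (Fin n)) ∘ₗ
    differential M a ∘ₗ extendZero R M n (i + 1)

theorem extendZero_gradedDifferential (a : Fin n → R) {i : ℕ} (f : CardSubset n (i + 1) → M) :
    extendZero R M n i (gradedDifferential M a i f) =
      differential M a (extendZero R M n (i + 1) f) :=
  extendZero_restrict (differential_card a (extendZero_card f))

theorem gradedDifferential_comp (a : Fin n → R) (i : ℕ) :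
    gradedDifferential M a i ∘ₗ gradedDifferential M a (i + 1) = 0 := by
  refine LinearMap.ext fun f => ?_
  apply extendZero_injective (R := R)
  rw [LinearMap.comp_apply, extendZero_gradedDifferential, extendZero_gradedDifferential,
    differential_differential, LinearMap.zero_apply, map_zero]

theorem koszulExactAt_succ_iff (a : Fin n → R) (i : ℕ) :
    KoszulExactAt M a (i + 1) ↔ ∀ f, gradedDifferential M a i f = 0 →
      ∃ g, gradedDifferential M a (i + 1) g = f := by
  constructor
  · intro h f hf
    obtain ⟨g, hg, hgd⟩ := h (extendZero R M n (i + 1) f) (extendZero_card f)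
      (by rw [← extendZero_gradedDifferential, hf, map_zero])
    refine ⟨fun S => g S, extendZero_injective (R := R) _ ?_⟩
    rw [extendZero_gradedDifferential, extendZero_restrict hg, hgd]
  · intro h f hf hd
    obtain ⟨g, hg⟩ := h (fun S => f S) (by
      apply extendZero_injective (R := R)
      rw [extendZero_gradedDifferential, extendZero_restrict hf, hd, map_zero])
    refine ⟨extendZero R M n (i + 2) g, extendZero_card g, ?_⟩
    rw [← extendZero_gradedDifferential, hg, extendZero_restrict hf]

theorem koszulExactAt_zero_iff (a : Fin n → R) :
    KoszulExactAt M a 0 ↔ ∀ f, ∃ g, gradedDifferential M a 0 g = f := by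
  constructor
  · intro h f
    obtain ⟨g, hg, hgd⟩ := h (extendZero R M n 0 f) (extendZero_card f)
      (differential_card_zero a (extendZero_card f))
    refine ⟨fun S => g S, extendZero_injective (R := R) _ ?_⟩
    rw [extendZero_gradedDifferential, extendZero_restrict hg, hgd]
  · intro h f hf hd
    obtain ⟨g, hg⟩ := h (fun S => f S)
    refine ⟨extendZero R M n 1 g, extendZero_card g, ?_⟩
    rw [← extendZero_gradedDifferential, hg, extendZero_restrict hf]

/-- In degree `0` the ideal `(a_1, …, a_n)` consists of boundaries. -/
theorem exists_gradedDifferential_zero (a : Fin n → R) (f : CardSubset n 0 → R)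
    (hf : f ⟨∅, Finset.card_empty⟩ ∈ Ideal.span (Set.range a)) :
    ∃ g, gradedDifferential R a 0 g = f := by
  have hc : ∀ S, S.card ≠ 0 → (Pi.single ∅ 1 : Finset (Fin n) → R) S = 0 := fun S hS => by
    rw [Pi.single_apply, if_neg]
    rintro rfl
    exact hS rfl
  obtain ⟨g, hg, hgd⟩ := exists_differential_eq_smul a hf hc (differential_card_zero a hc)
  refine ⟨fun S => g S, extendZero_injective (R := R) _ ?_⟩
  rw [extendZero_gradedDifferential, extendZero_restrict hg, hgd]
  funext S
  by_cases hS : S = ∅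
  · subst hS
    simp [extendZero]
  · rw [extendZero_card f S (by simpa using hS)]
    simp [hS]

/-- The Koszul complex of `a_1, …, a_n` over `R`. -/
abbrev koszulComplex (a : Fin n → R) : ChainComplex (ModuleCat.{u} R) ℕ :=
  ChainComplex.of (fun i => ModuleCat.of R (CardSubset n i → R))
    (fun i => ModuleCat.ofHom (gradedDifferential R a i))
    (fun i => by rw [← ModuleCat.ofHom_comp, gradedDifferential_comp]; rfl)

theorem koszulComplex_d (a : Fin n → R) (i : ℕ) :
    (koszulComplex a).d (i + 1) i = ModuleCat.ofHom (gradedDifferential R a i) :=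
  ChainComplex.of_d (fun i => ModuleCat.of R (CardSubset n i → R))
    (fun i => ModuleCat.ofHom (gradedDifferential R a i)) i

/-- The natural isomorphism `M ⊗ R^ι ≅ M^ι` carries `M ⊗ d` to the differential with coefficients
in `M`. -/
theorem piScalarRight_lTensor_gradedDifferential (a : Fin n → R) (i : ℕ)
    (x : TensorProduct R M (CardSubset n (i + 1) → R)) :
    TensorProduct.piScalarRight R R M (CardSubset n i)
        ((gradedDifferential R a i).lTensor M x) =
      gradedDifferential M a i (TensorProduct.piScalarRight R R M (CardSubset n (i + 1)) x) := by
  induction x using TensorProduct.induction_on with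
  | zero => simp
  | add x y hx hy => simp only [map_add, hx, hy]
  | tmul m f =>
    have h : extendZero R M n (i + 1) (fun j => f j • m) =
        fun S => LinearMap.toSpanSingleton R M m (extendZero R R n (i + 1) f S) := by
      funext S
      by_cases hS : S.card = i + 1
      · simp [extendZero, hS]
      · simp [extendZero, hS]
    simp only [LinearMap.lTensor_tmul, TensorProduct.piScalarRight_apply,
      TensorProduct.piScalarRightHom_tmul]
    funext S
    simp only [gradedDifferential, LinearMap.comp_apply, LinearMap.funLeft_apply]
    rw [h, differential_map]
    rfl

end Graded

section Resolution

variable (k : Type u) [Field k] (n : ℕ)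

theorem residue_comp_eq_zero :
    (koszulComplex (X : Fin n → MvPolynomial (Fin n) k)).d 1 0 ≫
      ModuleCat.ofHom ((irrelevantIdeal k n).mkQ ∘ₗ
        LinearMap.proj (⟨∅, Finset.card_empty⟩ : CardSubset n 0)) = 0 := by
  rw [koszulComplex_d, ← ModuleCat.ofHom_comp]
  refine ModuleCat.hom_ext (LinearMap.ext fun f => ?_)
  change Submodule.Quotient.mk (gradedDifferential (MvPolynomial (Fin n) k) X 0 f ⟨∅, _⟩) = 0
  rw [Submodule.Quotient.mk_eq_zero]
  change differential _ X _ ∅ ∈ _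
  rw [differential_apply]
  refine Submodule.sum_mem _ fun v _ => zsmul_mem ?_ _
  exact Ideal.mul_mem_right _ _ (Ideal.subset_span (Set.mem_range_self v))

/-- The augmentation of the Koszul complex onto the residue field. -/
def koszulAugmentation : koszulComplex (X : Fin n → MvPolynomial (Fin n) k) ⟶
    (ChainComplex.single₀ _).obj (ModuleCat.of (MvPolynomial (Fin n) k)
      (MvPolynomial (Fin n) k ⧸ irrelevantIdeal k n)) :=
  (ChainComplex.toSingle₀Equiv _ _).symm ⟨_, residue_comp_eq_zero k n⟩

theorem koszulAugmentation_quasiIso : QuasiIso (koszulAugmentation k n) where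
  quasiIsoAt m := by
    cases m with
    | zero =>
      rw [ChainComplex.quasiIsoAt₀_iff, ShortComplex.quasiIso_iff_of_zeros' _ rfl rfl rfl]
      constructor
      · rw [ShortComplex.moduleCat_exact_iff]
        intro f hf
        change ((koszulAugmentation k n).f 0).hom f = 0 at hf
        change ∃ g, ((koszulComplex X).d 1 0).hom g = f
        rw [koszulAugmentation, ChainComplex.toSingle₀Equiv_symm_apply_f_zero] at hf
        rw [koszulComplex_d]
        change Submodule.Quotient.mk (f ⟨∅, _⟩) = 0 at hf
        rw [Submodule.Quotient.mk_eq_zero] at hf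
        exact exists_gradedDifferential_zero X f hf
      · rw [ModuleCat.epi_iff_surjective]
        intro x
        change ∃ y, ((koszulAugmentation k n).f 0).hom y = x
        rw [koszulAugmentation, ChainComplex.toSingle₀Equiv_symm_apply_f_zero]
        obtain ⟨p, rfl⟩ := Submodule.mkQ_surjective _ x
        exact ⟨fun _ => p, rfl⟩
    | succ m =>
      rw [quasiIsoAt_iff_exactAt' (hL := ChainComplex.exactAt_succ_single_obj ..),
        HomologicalComplex.exactAt_iff' _ (m + 2) (m + 1) m (by simp) (by simp),
        ShortComplex.moduleCat_exact_iff]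
      have h := (koszulExactAt_succ_iff (M := MvPolynomial (Fin n) k) X m).1
        (fun f hf hd => koszul_exact k m f hf hd)
      intro f hf
      change ((koszulComplex X).d (m + 1) m).hom f = 0 at hf
      change ∃ g, ((koszulComplex X).d (m + 1 + 1) (m + 1)).hom g = f
      rw [koszulComplex_d] at hf ⊢
      exact h f hf

/-- The Koszul complex of the variables is a free resolution of the residue field. -/
def koszulResolution : ProjectiveResolution (ModuleCat.of (MvPolynomial (Fin n) k)
    (MvPolynomial (Fin n) k ⧸ irrelevantIdeal k n)) where
  complex := koszulComplex X
  projective i := by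
    have : Module.Projective (MvPolynomial (Fin n) k) (CardSubset n i → MvPolynomial (Fin n) k) :=
      inferInstance
    exact (IsProjective.iff_projective _).1 this
  π := koszulAugmentation k n
  quasiIso := koszulAugmentation_quasiIso k n

end Resolution

theorem tensor_exactAt_succ_iff {R : Type u} [CommRing R] (M : ModuleCat.{u} R)
    (K : ChainComplex (ModuleCat.{u} R) ℕ) (i : ℕ) :
    ((((MonoidalCategory.tensoringLeft (ModuleCat.{u} R)).obj M).mapHomologicalComplex _).obj
        K).ExactAt (i + 1) ↔
      ∀ x : TensorProduct R M (K.X (i + 1)), (K.d (i + 1) i).hom.lTensor M x = 0 →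
        ∃ y, (K.d (i + 1 + 1) (i + 1)).hom.lTensor M y = x := by
  rw [HomologicalComplex.exactAt_iff' _ (i + 2) (i + 1) i (by simp) (by simp),
      ShortComplex.moduleCat_exact_iff]
  rfl

/-- In degree `0` every element is a cycle, as the complex has no term in degree `-1`. -/
theorem tensor_exactAt_zero_iff {R : Type u} [CommRing R] (M : ModuleCat.{u} R)
    (K : ChainComplex (ModuleCat.{u} R) ℕ) :
    ((((MonoidalCategory.tensoringLeft (ModuleCat.{u} R)).obj M).mapHomologicalComplex _).obj
        K).ExactAt 0 ↔
      ∀ x : TensorProduct R M (K.X 0), ∃ y, (K.d 1 0).hom.lTensor M y = x := by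
  rw [HomologicalComplex.exactAt_iff' _ 1 0 0 (by simp) (by simp),
      ShortComplex.moduleCat_exact_iff]
  have h : ∀ x, ((((MonoidalCategory.tensoringLeft (ModuleCat.{u} R)).obj M).mapHomologicalComplex
      _).obj K).d 0 0 x = 0 := fun x => by
    rw [HomologicalComplex.shape _ _ _ (by simp)]
    rfl
  exact ⟨fun H x => H x (h x), fun H x _ => H x⟩

/-- Tensoring the Koszul resolution with `M` computes `Tor(M, k)`, so the vanishing of
`Tor_i(M, k)` is the exactness in degree `i` of the Koszul complex with coefficients in `M`. -/
theorem isZero_residueTor_iff (k : Type u) [Field k] (n : ℕ) (M : Type u) [AddCommGroup M]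
    [Module (MvPolynomial (Fin n) k) M] (i : ℕ) : Limits.IsZero (residueTor k n M i) ↔
      KoszulExactAt M (X : Fin n → MvPolynomial (Fin n) k) i := by
  rw [residueTor, Tor_obj,
    ((koszulResolution k n).isoLeftDerivedObj _ i).isZero_iff,
    HomologicalComplex.homologyFunctor_obj, ← HomologicalComplex.exactAt_iff_isZero_homology]
  have hK : (koszulResolution k n).complex = koszulComplex X := rfl
  rw [hK]
  cases i with
  | zero =>
    rw [tensor_exactAt_zero_iff, koszulExactAt_zero_iff, koszulComplex_d]
    let e := fun i => TensorProduct.piScalarRight (MvPolynomial (Fin n) k)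
      (MvPolynomial (Fin n) k) M (CardSubset n i)
    constructor
    · intro h f
      obtain ⟨y, hy⟩ := h ((e 0).symm f)
      refine ⟨e 1 y, ?_⟩
      rw [← piScalarRight_lTensor_gradedDifferential]
      exact (e 0).eq_symm_apply.1 hy
    · intro h x
      obtain ⟨g, hg⟩ := h (e 0 x)
      refine ⟨(e 1).symm g, (e 0).injective ?_⟩
      refine (piScalarRight_lTensor_gradedDifferential _ _ _).trans ?_
      rw [← hg]
      exact congrArg _ ((e 1).apply_symm_apply g)
  | succ i =>
    rw [tensor_exactAt_succ_iff, koszulExactAt_succ_iff, koszulComplex_d, koszulComplex_d]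
    let e := fun i => TensorProduct.piScalarRight (MvPolynomial (Fin n) k)
      (MvPolynomial (Fin n) k) M (CardSubset n i)
    constructor
    · intro h f hf
      obtain ⟨y, hy⟩ := h ((e (i + 1)).symm f) ((e i).injective (by
        refine (piScalarRight_lTensor_gradedDifferential _ _ _).trans ?_
        rw [map_zero, ← hf]
        exact congrArg _ ((e (i + 1)).apply_symm_apply f)))
      refine ⟨e (i + 2) y, ?_⟩
      rw [← piScalarRight_lTensor_gradedDifferential]
      exact (e (i + 1)).eq_symm_apply.1 hy
    · intro h x hx
      obtain ⟨g, hg⟩ := h (e (i + 1) x) (by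
        rw [← piScalarRight_lTensor_gradedDifferential]
        exact (congrArg (e i) hx).trans (map_zero _))
      refine ⟨(e (i + 2)).symm g, (e (i + 1)).injective ?_⟩
      refine (piScalarRight_lTensor_gradedDifferential _ _ _).trans ?_
      rw [← hg]
      exact congrArg _ ((e (i + 2)).apply_symm_apply g)

/-! ### Exponents and the Stanley-Reisner ideal -/

section Multigraded

variable {n : ℕ}

/-- The exponent of the squarefree monomial `x^S`. -/
def sqfreeExponent (S : Finset (Fin n)) : Fin n →₀ ℕ :=
  Finsupp.equivFunOnFinite.symm fun i => if i ∈ S then 1 else 0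

theorem sqfreeExponent_apply (S : Finset (Fin n)) (i : Fin n) :
    sqfreeExponent S i = if i ∈ S then 1 else 0 :=
  rfl

theorem sqfreeExponent_le_iff {S : Finset (Fin n)} {a : Fin n →₀ ℕ} :
    sqfreeExponent S ≤ a ↔ S ⊆ a.support := by
  constructor
  · intro h i hi
    have := h i
    rw [sqfreeExponent_apply, if_pos hi] at this
    exact Finsupp.mem_support_iff.2 (by omega)
  · intro h i
    rw [sqfreeExponent_apply]
    split_ifs with hi
    · exact Nat.one_le_iff_ne_zero.2 (Finsupp.mem_support_iff.1 (h hi))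
    · exact Nat.zero_le _

theorem degree_sqfreeExponent (S : Finset (Fin n)) : (sqfreeExponent S).degree = S.card := by
  rw [Finsupp.degree_eq_sum]
  simp [sqfreeExponent_apply]

theorem sqfreeExponent_insert {v : Fin n} {T : Finset (Fin n)} (hv : v ∉ T) :
    sqfreeExponent (insert v T) = sqfreeExponent T + Finsupp.single v 1 := by
  ext i
  by_cases h : i = v
  · subst h
    simp [sqfreeExponent_apply, hv]
  · simp [sqfreeExponent_apply, h]

theorem prod_X_eq_monomial (k : Type*) [Field k] (S : Finset (Fin n)) :
    (∏ i ∈ S, X i : MvPolynomial (Fin n) k) = monomial (sqfreeExponent S) 1 := by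
  rw [monomial_eq, C_1, one_mul, Finsupp.prod_fintype _ _ (fun _ => pow_zero _)]
  simp [sqfreeExponent_apply, pow_ite, Finset.prod_ite_mem]

theorem support_sub_sqfreeExponent (a : Fin n →₀ ℕ) (S : Finset (Fin n)) (i : Fin n) :
    i ∈ (a - sqfreeExponent S).support ↔ (if i ∈ S then 1 else 0) < a i := by
  rw [Finsupp.mem_support_iff, Finsupp.tsub_apply, sqfreeExponent_apply]
  omega

/-- A Stanley-Reisner ideal is spanned by the monomials whose support is a nonface. -/
theorem mem_stanleyReisnerIdeal_iff {k : Type u} [Field k] {Δ : SimplicialComplex n}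
    {p : MvPolynomial (Fin n) k} :
    p ∈ stanleyReisnerIdeal k Δ ↔ ∀ b ∈ p.support, b.support ∉ Δ.faces := by
  have h : {p : MvPolynomial (Fin n) k | ∃ F : Finset (Fin n), F ∉ Δ.faces ∧ p = ∏ i ∈ F, X i} =
      (fun s => monomial s (1 : k)) '' (sqfreeExponent '' Δ.facesᶜ) := by
    ext p
    simp only [Set.mem_ofPred_eq, Set.mem_image, Set.mem_compl_iff, prod_X_eq_monomial,
      exists_exists_and_eq_and, eq_comm (a := p)]
  rw [stanleyReisnerIdeal, h, mem_ideal_span_monomial_image]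
  refine forall₂_congr fun b _ => ?_
  simp only [Set.mem_image, Set.mem_compl_iff, exists_exists_and_eq_and, sqfreeExponent_le_iff]
  exact ⟨fun ⟨F, hF, hb⟩ h => hF (Δ.down_closed h hb), fun h => ⟨_, h, subset_rfl⟩⟩

/-! ### Multigraded components of Koszul chains -/

variable {k : Type u} [Field k]

/-- The chain `∑_S c(S) x^{a - S} e_S` of multidegree `a`, the sum over `S` in the support
of `a`. -/
def ofMultidegree (a : Fin n →₀ ℕ) (c : Finset (Fin n) → k) :
    Finset (Fin n) → MvPolynomial (Fin n) k :=
  fun S => if S ⊆ a.support then monomial (a - sqfreeExponent S) (c S) else 0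

/-- The coefficients `c(S)` of the component `∑_S c(S) x^{a - S} e_S` of multidegree `a`. -/
def component (a : Fin n →₀ ℕ) (f : Finset (Fin n) → MvPolynomial (Fin n) k) :
    Finset (Fin n) → k :=
  fun S => if S ⊆ a.support then coeff (a - sqfreeExponent S) (f S) else 0

theorem component_ofMultidegree (a : Fin n →₀ ℕ) {c : Finset (Fin n) → k}
    (hc : ∀ S, ¬ S ⊆ a.support → c S = 0) : component a (ofMultidegree a c) = c := by
  funext S
  by_cases h : S ⊆ a.support
  · simp [component, ofMultidegree, h]
  · simp [component, h, hc S h]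

/-- In a fixed multidegree the Koszul differential is the simplicial boundary map. -/
theorem differential_ofMultidegree (a : Fin n →₀ ℕ) {c : Finset (Fin n) → k}
    (hc : ∀ S, ¬ S ⊆ a.support → c S = 0) :
    differential _ (X : Fin n → MvPolynomial (Fin n) k) (ofMultidegree a c) =
      ofMultidegree a (boundary k n c) := by
  funext T
  rw [differential_apply, ofMultidegree]
  by_cases hT : T ⊆ a.support
  · rw [if_pos hT, boundary, differential_apply, map_sum]
    refine Finset.sum_congr rfl fun v hv => ?_
    have hvT : v ∉ T := Finset.mem_compl.1 hv
    rw [map_zsmul, one_smul, ofMultidegree]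
    congr 1
    by_cases hva : v ∈ a.support
    · have hins : insert v T ⊆ a.support := Finset.insert_subset hva hT
      rw [if_pos hins, smul_eq_mul, X, monomial_mul, one_mul]
      congr 2
      have hle := sqfreeExponent_le_iff.2 hins
      rw [sqfreeExponent_insert hvT] at hle ⊢
      ext i
      have := hle i
      simp only [Finsupp.add_apply, Finsupp.tsub_apply] at this ⊢
      omega
    · have hins : ¬ insert v T ⊆ a.support := fun h => hva (h (Finset.mem_insert_self _ _))
      rw [if_neg hins, hc _ hins, smul_zero, map_zero]
  · rw [if_neg hT]
    refine Finset.sum_eq_zero fun v _ => ?_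
    rw [ofMultidegree, if_neg fun h => hT ((Finset.subset_insert _ _).trans h), smul_zero,
      smul_zero]

theorem component_differential (a : Fin n →₀ ℕ)
    (f : Finset (Fin n) → MvPolynomial (Fin n) k) :
    component a (differential _ (X : Fin n → MvPolynomial (Fin n) k) f) =
      boundary k n (component a f) := by
  funext T
  rw [component, boundary, differential_apply]
  by_cases hT : T ⊆ a.support
  · rw [if_pos hT, differential_apply, coeff_sum]
    refine Finset.sum_congr rfl fun v hv => ?_
    have hvT : v ∉ T := Finset.mem_compl.1 hv
    rw [one_smul, ← coeffAddMonoidHom_apply, map_zsmul, coeffAddMonoidHom_apply, smul_eq_mul,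
      coeff_X_mul', component]
    congr 1
    by_cases hva : v ∈ a.support
    · rw [if_pos (Finset.insert_subset hva hT), if_pos, sqfreeExponent_insert hvT, tsub_tsub]
      rw [support_sub_sqfreeExponent, if_neg hvT]
      exact Nat.pos_of_ne_zero (Finsupp.mem_support_iff.1 hva)
    · have hins : ¬ insert v T ⊆ a.support := fun h => hva (h (Finset.mem_insert_self _ _))
      rw [if_neg hins, if_neg]
      rw [support_sub_sqfreeExponent, if_neg hvT, Finsupp.notMem_support_iff.1 hva]
      simp
  · rw [if_neg hT]
    refine (Finset.sum_eq_zero fun v _ => ?_).symm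
    rw [component, if_neg fun h => hT ((Finset.subset_insert _ _).trans h), smul_zero, smul_zero]

theorem component_eq_zero_of_mem {Δ : SimplicialComplex n} (a : Fin n →₀ ℕ)
    {f : Finset (Fin n) → MvPolynomial (Fin n) k} {S : Finset (Fin n)}
    (hf : f S ∈ stanleyReisnerIdeal k Δ) (hS : (a - sqfreeExponent S).support ∈ Δ.faces) :
    component a f S = 0 := by
  rw [component]
  split_ifs
  · by_contra h
    exact mem_stanleyReisnerIdeal_iff.1 hf _ (mem_support_iff.2 h) hS
  · rfl

theorem ofMultidegree_mem {Δ : SimplicialComplex n} {a : Fin n →₀ ℕ} {c : Finset (Fin n) → k}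
    {S : Finset (Fin n)}
    (hc : S ⊆ a.support → (a - sqfreeExponent S).support ∈ Δ.faces → c S = 0) :
    ofMultidegree a c S ∈ stanleyReisnerIdeal k Δ := by
  rw [ofMultidegree]
  split_ifs with h
  · rw [mem_stanleyReisnerIdeal_iff]
    intro b hb hbf
    obtain rfl := Finset.mem_singleton.1 (support_monomial_subset hb)
    rw [hc h hbf] at hb
    simp at hb
  · exact Ideal.zero_mem _

/-- A chain is the sum of its multigraded components. -/
theorem sum_ofMultidegree_component {f : Finset (Fin n) → MvPolynomial (Fin n) k}
    {A : Finset (Fin n →₀ ℕ)} (hA : ∀ S, ∀ b ∈ (f S).support, b + sqfreeExponent S ∈ A)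
    (S : Finset (Fin n)) : ∑ a ∈ A, ofMultidegree a (component a f) S = f S := by
  ext b
  rw [coeff_sum]
  have hle : S ⊆ (b + sqfreeExponent S).support := sqfreeExponent_le_iff.1 le_add_self
  rw [Finset.sum_eq_single (b + sqfreeExponent S)]
  · rw [ofMultidegree, if_pos hle, component, if_pos hle, add_tsub_cancel_right, coeff_monomial,
      if_pos rfl]
  · intro a _ hab
    rw [ofMultidegree]
    split_ifs with h
    · rw [coeff_monomial, if_neg]
      rintro rfl
      exact hab (tsub_add_cancel_of_le (sqfreeExponent_le_iff.2 h)).symm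
    · exact coeff_zero _
  · intro h
    rw [ofMultidegree, if_pos hle, component, if_pos hle, add_tsub_cancel_right, coeff_monomial,
      if_pos rfl]
    by_contra hb
    exact h (hA S b (mem_support_iff.2 hb))

/-- Exactness in homological degree `i` of the component of multidegree `a` of the Koszul complex
of the Stanley-Reisner ring of `Δ`. A chain `∑_S c(S) x^{a - S} e_S` is recorded by its
coefficients, and a coefficient counts only if `x^{a - S}` is a nonzero monomial of the ring. -/
def MultigradedExact (k : Type u) [Field k] (Δ : SimplicialComplex n) (a : Fin n →₀ ℕ) (i : ℕ) :
    Prop :=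
  ∀ c : Finset (Fin n) → k, (∀ S, ¬ (S.card = i ∧ S ⊆ a.support) → c S = 0) →
    (∀ T ⊆ a.support, (a - sqfreeExponent T).support ∈ Δ.faces → boundary k n c T = 0) →
    ∃ e : Finset (Fin n) → k, (∀ S, ¬ (S.card = i + 1 ∧ S ⊆ a.support) → e S = 0) ∧
      ∀ S ⊆ a.support, (a - sqfreeExponent S).support ∈ Δ.faces → boundary k n e S = c S

/-- A chain over `k[x_1, …, x_n]` that is a cycle modulo the Stanley-Reisner ideal is a boundary
modulo that ideal as soon as its multigraded components are. The multidegrees of the bounding chain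
are among those of the given one, so that gradings are respected. -/
theorem exists_differential_sub_mem {Δ : SimplicialComplex n} {i : ℕ}
    {f : Finset (Fin n) → MvPolynomial (Fin n) k} (hf : ∀ S, S.card ≠ i → f S = 0)
    (hd : ∀ T, differential _ (X : Fin n → MvPolynomial (Fin n) k) f T ∈ stanleyReisnerIdeal k Δ)
    {A : Finset (Fin n →₀ ℕ)} (hA : ∀ S, ∀ b ∈ (f S).support, b + sqfreeExponent S ∈ A)
    (H : ∀ a ∈ A, MultigradedExact k Δ a i) :
    ∃ g : Finset (Fin n) → MvPolynomial (Fin n) k, (∀ S, S.card ≠ i + 1 → g S = 0) ∧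
      (∀ S, differential _ (X : Fin n → MvPolynomial (Fin n) k) g S - f S ∈
        stanleyReisnerIdeal k Δ) ∧
      ∀ S, ∀ b ∈ (g S).support, b + sqfreeExponent S ∈ A := by
  have H' : ∀ a ∈ A, ∃ e : Finset (Fin n) → k,
      (∀ S, ¬ (S.card = i + 1 ∧ S ⊆ a.support) → e S = 0) ∧
      ∀ S ⊆ a.support, (a - sqfreeExponent S).support ∈ Δ.faces →
        boundary k n e S = component a f S := by
    intro a ha
    refine H a ha _ ?_ ?_
    · intro S hS
      rw [component]
      split_ifs with h
      · rw [hf S fun hc => hS ⟨hc, h⟩, coeff_zero]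
      · rfl
    · intro T _ hT
      rw [← component_differential]
      exact component_eq_zero_of_mem a (hd T) hT
  choose! e he hed using H'
  refine ⟨fun S => ∑ a ∈ A, ofMultidegree a (e a) S, ?_, ?_, ?_⟩
  · intro S hS
    refine Finset.sum_eq_zero fun a ha => ?_
    rw [ofMultidegree, he a ha S fun h => hS h.1, map_zero, ite_self]
  · intro S
    have h1 : (fun S => ∑ a ∈ A, ofMultidegree a (e a) S) = ∑ a ∈ A, ofMultidegree a (e a) := by
      funext S
      rw [Finset.sum_apply]
    rw [h1, map_sum, Finset.sum_apply, ← sum_ofMultidegree_component hA S,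
      ← Finset.sum_sub_distrib]
    refine Ideal.sum_mem _ fun a ha => ?_
    rw [differential_ofMultidegree a fun S hS => he a ha S fun h => hS h.2]
    have h2 : ofMultidegree a (boundary k n (e a)) S - ofMultidegree a (component a f) S =
        ofMultidegree a (boundary k n (e a) - component a f) S := by
      simp only [ofMultidegree]
      split_ifs
      · rw [Pi.sub_apply, map_sub]
      · rw [sub_zero]
    rw [h2]
    exact ofMultidegree_mem fun hS hSf => by rw [Pi.sub_apply, hed a ha S hS hSf, sub_self]
  · intro S b hb
    obtain ⟨a, ha, hab⟩ := Finset.mem_biUnion.1 (support_sum hb)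
    rw [ofMultidegree] at hab
    split_ifs at hab with h
    · obtain rfl := Finset.mem_singleton.1 (support_monomial_subset hab)
      rwa [tsub_add_cancel_of_le (sqfreeExponent_le_iff.2 h)]
    · simp at hab

/-- The Koszul complex of a Stanley-Reisner ring is exact where all its multigraded components
are. -/
theorem koszulExactAt_of_multigradedExact {Δ : SimplicialComplex n} {i : ℕ}
    (H : ∀ a, MultigradedExact k Δ a i) :
    KoszulExactAt (MvPolynomial (Fin n) k ⧸ stanleyReisnerIdeal k Δ)
      (X : Fin n → MvPolynomial (Fin n) k) i := by
  intro f hf hd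
  set φ := (stanleyReisnerIdeal k Δ).mkQ
  obtain ⟨g, hg, hgf⟩ := exists_chain_lift (φ := φ) (Submodule.mkQ_surjective _) hf
  obtain rfl : f = fun S => φ (g S) := funext fun S => (hgf S).symm
  rw [differential_map] at hd
  obtain ⟨h, hh, hhd, -⟩ := exists_differential_sub_mem hg
    (fun T => (Submodule.Quotient.mk_eq_zero _).1 (congrFun hd T))
    (A := Finset.univ.biUnion fun S => (g S).support.image (· + sqfreeExponent S))
    (fun S b hb => Finset.mem_biUnion.2 ⟨S, Finset.mem_univ _, Finset.mem_image_of_mem _ hb⟩)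
    (fun a _ => H a)
  refine ⟨fun S => φ (h S), fun S hS => by simp [hh S hS], ?_⟩
  rw [differential_map]
  funext S
  exact (Submodule.Quotient.eq _).2 (hhd S)

theorem mem_quotientPiece_iff {I : Ideal (MvPolynomial (Fin n) k)} {m : ℕ}
    {q : MvPolynomial (Fin n) k ⧸ I} :
    q ∈ quotientPiece I m ↔ ∃ p : MvPolynomial (Fin n) k, p.IsHomogeneous m ∧ I.mkQ p = q :=
  Iff.rfl

/-- `Tor_i(R/I, k)_j` is the sum of the components whose multidegree has total degree `j`. -/
theorem gradedBetti_eq_zero_of_multigradedExact {Δ : SimplicialComplex n} {i j : ℕ}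
    (H : ∀ a : Fin n →₀ ℕ, a.degree = j → MultigradedExact k Δ a i) :
    gradedBetti (stanleyReisnerIdeal k Δ) i j = 0 := by
  set I := stanleyReisnerIdeal k Δ
  set φ := I.mkQ
  suffices h : koszulChains I i j ⊓ LinearMap.ker (koszulDifferential I) ≤
      (koszulChains I (i + 1) j).map (koszulDifferential I) by
    have : Subsingleton (gradedTor I i j) :=
      Submodule.Quotient.subsingleton_iff.2 (Submodule.submoduleOf_eq_top.2 h)
    exact Module.finrank_zero_of_subsingleton
  rintro f ⟨hf, hd⟩
  have hlift : ∀ S, ∃ p : MvPolynomial (Fin n) k, (S.card = i ∧ i ≤ j → p.IsHomogeneous (j - i)) ∧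
      (¬ (S.card = i ∧ i ≤ j) → p = 0) ∧ φ p = f S := by
    intro S
    by_cases h : S.card = i ∧ i ≤ j
    · obtain ⟨p, hp, hpf⟩ := mem_quotientPiece_iff.1 ((hf S).1 h)
      exact ⟨p, fun _ => hp, fun h' => absurd h h', hpf⟩
    · exact ⟨0, fun h' => absurd h' h, fun _ => rfl, by rw [(hf S).2 h, map_zero]⟩
  choose g hg1 hg2 hgf using hlift
  obtain rfl : f = fun S => φ (g S) := funext fun S => (hgf S).symm
  have hd : differential _ X (fun S => φ (g S)) = 0 := hd
  rw [differential_map] at hd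
  obtain ⟨h, hh, hhd, hhA⟩ := exists_differential_sub_mem (fun S hS => hg2 S fun h => hS h.1)
    (fun T => (Submodule.Quotient.mk_eq_zero _).1 (congrFun hd T))
    (A := (Finsupp.finite_of_degree_eq (σ := Fin n) j).toFinset)
    (fun S b hb => by
      rw [Set.Finite.mem_toFinset, Set.mem_ofPred_eq, map_add, degree_sqfreeExponent]
      by_cases hS : S.card = i ∧ i ≤ j
      · have : b.degree = j - i := by
          by_contra hb'
          exact mem_support_iff.1 hb ((hg1 S hS).coeff_eq_zero hb')
        omega
      · rw [hg2 S hS] at hb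
        simp at hb)
    (fun a ha => H a ((Finsupp.finite_of_degree_eq j).mem_toFinset.1 ha))
  refine ⟨fun S => φ (h S), fun S => ⟨fun hS => ?_, fun hS => ?_⟩, ?_⟩
  · refine mem_quotientPiece_iff.2 ⟨h S, ?_, rfl⟩
    rw [← mem_homogeneousSubmodule, homogeneousSubmodule_eq_finsupp_supported]
    intro b hb
    have := (Set.Finite.mem_toFinset _).1 (hhA S b hb)
    rw [Set.mem_ofPred_eq, map_add, degree_sqfreeExponent] at this
    rw [Set.mem_ofPred_eq]
    omega
  · by_cases hc : S.card = i + 1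
    · have h0 : h S = 0 := by
        rw [← support_eq_empty, Finset.eq_empty_iff_forall_notMem]
        intro b hb
        have := (Set.Finite.mem_toFinset _).1 (hhA S b hb)
        rw [Set.mem_ofPred_eq, map_add, degree_sqfreeExponent] at this
        omega
      simp [h0]
    · simp [hh S hc]
  · change differential _ X (fun S => φ (h S)) = _
    rw [differential_map]
    funext S
    exact (Submodule.Quotient.eq _).2 (hhd S)

theorem finiteDimensional_koszulChains (I : Ideal (MvPolynomial (Fin n) k)) (i j : ℕ) :
    FiniteDimensional k (koszulChains I i j) := by
  have : FiniteDimensional k (quotientPiece I (j - i)) :=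
    Module.Finite.iff_fg.2 ((homogeneousSubmodule_fg _ _ (j - i)).map _)
  let φ : koszulChains I i j →ₗ[k] (Finset (Fin n) → quotientPiece I (j - i)) :=
    LinearMap.pi fun S => LinearMap.codRestrict _
      (LinearMap.proj S ∘ₗ (koszulChains I i j).subtype) fun f => by
        by_cases h : S.card = i ∧ i ≤ j
        · exact (f.2 S).1 h
        · have := (f.2 S).2 h
          simp [this]
  refine FiniteDimensional.of_injective φ fun f g hfg => ?_
  ext S
  exact congrArg Subtype.val (congrFun hfg S)

/-- A chain of multidegree `a` whose class in the Koszul complex of the Stanley-Reisner ring is a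
boundary is already the boundary of a chain of multidegree `a`. -/
theorem exists_boundary_eq_of_differential_eq {Δ : SimplicialComplex n} {a : Fin n →₀ ℕ} {i : ℕ}
    {c : Finset (Fin n) → k} (hc : ∀ S, ¬ S ⊆ a.support → c S = 0)
    {g : Finset (Fin n) → MvPolynomial (Fin n) k ⧸ stanleyReisnerIdeal k Δ}
    (hg : ∀ S, S.card ≠ i + 1 → g S = 0)
    (hgd : differential _ (X : Fin n → MvPolynomial (Fin n) k) g =
      fun S => (stanleyReisnerIdeal k Δ).mkQ (ofMultidegree a c S)) :
    ∃ e : Finset (Fin n) → k, (∀ S, ¬ (S.card = i + 1 ∧ S ⊆ a.support) → e S = 0) ∧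
      ∀ S ⊆ a.support, (a - sqfreeExponent S).support ∈ Δ.faces → boundary k n e S = c S := by
  obtain ⟨h, hh, hhg⟩ := exists_chain_lift (φ := (stanleyReisnerIdeal k Δ).mkQ)
    (Submodule.mkQ_surjective _) hg
  obtain rfl : g = fun S => (stanleyReisnerIdeal k Δ).mkQ (h S) := funext fun S => (hhg S).symm
  rw [differential_map] at hgd
  refine ⟨component a h, fun S hS => ?_, fun S hS hSf => ?_⟩
  · rw [component]
    split_ifs with h'
    · rw [hh S fun h'' => hS ⟨h'', h'⟩, coeff_zero]
    · rfl
  · have h1 := component_eq_zero_of_mem a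
      (f := differential _ X h - ofMultidegree a c)
      ((Submodule.Quotient.eq _).1 (congrFun hgd S)) hSf
    rw [← component_differential, ← sub_eq_zero, ← h1]
    conv_lhs => rw [← component_ofMultidegree a hc]
    simp [component, hS]

theorem differential_mk_ofMultidegree {Δ : SimplicialComplex n} {a : Fin n →₀ ℕ}
    {c : Finset (Fin n) → k} (hc : ∀ S, ¬ S ⊆ a.support → c S = 0)
    (hd : ∀ T ⊆ a.support, (a - sqfreeExponent T).support ∈ Δ.faces → boundary k n c T = 0) :
    differential _ (X : Fin n → MvPolynomial (Fin n) k)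
      (fun S => (stanleyReisnerIdeal k Δ).mkQ (ofMultidegree a c S)) = 0 := by
  rw [differential_map, differential_ofMultidegree a hc]
  funext T
  exact (Submodule.Quotient.mk_eq_zero _).2 (ofMultidegree_mem (hd T))

theorem KoszulExactAt.multigradedExact {Δ : SimplicialComplex n} {i : ℕ}
    (h : KoszulExactAt (MvPolynomial (Fin n) k ⧸ stanleyReisnerIdeal k Δ)
      (X : Fin n → MvPolynomial (Fin n) k) i) (a : Fin n →₀ ℕ) : MultigradedExact k Δ a i := by
  intro c hc hd
  have hc' : ∀ S, ¬ S ⊆ a.support → c S = 0 := fun S hS => hc S fun h => hS h.2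
  obtain ⟨g, hg, hgd⟩ := h (fun S => (stanleyReisnerIdeal k Δ).mkQ (ofMultidegree a c S))
    (fun S hS => by rw [ofMultidegree, hc S fun h => hS h.1, map_zero, ite_self, map_zero])
    (differential_mk_ofMultidegree hc' hd)
  exact exists_boundary_eq_of_differential_eq hc' hg hgd

/-- Finite dimensionality is what makes a vanishing `finrank` a vanishing homology group. -/
theorem multigradedExact_of_gradedBetti_eq_zero {Δ : SimplicialComplex n} {i : ℕ}
    {a : Fin n →₀ ℕ} (h : gradedBetti (stanleyReisnerIdeal k Δ) i a.degree = 0) :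
    MultigradedExact k Δ a i := by
  intro c hc hd
  have hc' : ∀ S, ¬ S ⊆ a.support → c S = 0 := fun S hS => hc S fun h => hS h.2
  set I := stanleyReisnerIdeal k Δ
  have := finiteDimensional_koszulChains I i a.degree
  have : FiniteDimensional k
      ↥(koszulChains I i a.degree ⊓ LinearMap.ker (koszulDifferential I)) :=
    Submodule.finiteDimensional_inf_left _ _
  rw [gradedBetti, Module.finrank_zero_iff, Submodule.Quotient.subsingleton_iff,
    Submodule.submoduleOf_eq_top] at h
  have hf : (fun S => I.mkQ (ofMultidegree a c S)) ∈ koszulChains I i a.degree := by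
    intro S
    have hdeg : S ⊆ a.support → a.degree = (a - sqfreeExponent S).degree + S.card := fun h => by
      rw [← degree_sqfreeExponent S, ← map_add, tsub_add_cancel_of_le (sqfreeExponent_le_iff.2 h)]
    refine ⟨fun hS => mem_quotientPiece_iff.2 ⟨_, ?_, rfl⟩, fun hS => ?_⟩
    · rw [ofMultidegree]
      split_ifs with h'
      · refine isHomogeneous_monomial _ ?_
        have := hdeg h'
        omega
      · exact isHomogeneous_zero _ _ _
    · change I.mkQ (ofMultidegree a c S) = 0
      rw [ofMultidegree]
      split_ifs with h'
      · rw [hc S, map_zero, map_zero]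
        have := hdeg h'
        omega
      · exact map_zero _
  obtain ⟨g, hg, hgd⟩ := h ⟨hf, differential_mk_ofMultidegree hc' hd⟩
  exact exists_boundary_eq_of_differential_eq hc' (fun S hS => (hg S).2 fun h => hS h.1) hgd

/-! ### Multidegrees that do not contribute -/

theorem boundary_cone (v : Fin n) (c : Finset (Fin n) → k) (S : Finset (Fin n)) :
    boundary k n (cone v c) S = c S - cone v (boundary k n c) S := by
  have := congrFun (differential_cone_add (fun _ => (1 : k)) v c) S
  rw [one_smul] at this
  exact eq_sub_of_add_eq this

/-- Since `∂(e_v c) + e_v ∂c = c`, a relative cycle `c` bounds `e_v c` provided `e_v ∂c` consists of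
terms that are zero in the Stanley-Reisner ring. -/
theorem multigradedExact_of_cone {Δ : SimplicialComplex n} {a : Fin n →₀ ℕ} {i : ℕ} (v : Fin n)
    (hv : v ∈ a.support)
    (H : ∀ c : Finset (Fin n) → k, (∀ S, ¬ (S.card = i ∧ S ⊆ a.support) → c S = 0) →
      (∀ T ⊆ a.support, (a - sqfreeExponent T).support ∈ Δ.faces → boundary k n c T = 0) →
      ∀ S ⊆ a.support, (a - sqfreeExponent S).support ∈ Δ.faces → v ∈ S →
        boundary k n c (S.erase v) = 0) :
    MultigradedExact k Δ a i := by
  intro c hc hd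
  refine ⟨cone v c, fun S hS => ?_, fun S hS hSf => ?_⟩
  · rw [cone]
    split_ifs with h
    · rw [hc, smul_zero]
      rintro ⟨h1, h2⟩
      refine hS ⟨?_, ?_⟩
      · rw [← Finset.card_erase_add_one h, h1]
      · rw [← Finset.insert_erase h]
        exact Finset.insert_subset hv h2
    · rfl
  · rw [boundary_cone, sub_eq_self, cone]
    split_ifs with h
    · rw [H c hc hd S hS hSf h, smul_zero]
    · rfl

/-- Multidegrees that are not squarefree contribute nothing: if `a_v ≥ 2`, the condition
`x^{a - S} ≠ 0` does not depend on whether `v ∈ S`. -/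
theorem multigradedExact_of_two_le (Δ : SimplicialComplex n) {a : Fin n →₀ ℕ} (i : ℕ) {v : Fin n}
    (hv : 2 ≤ a v) : MultigradedExact k Δ a i := by
  refine multigradedExact_of_cone v (Finsupp.mem_support_iff.2 (by omega))
    fun c _ hd S hS hSf hvS => hd _ ((Finset.erase_subset _ _).trans hS) ?_
  convert! hSf using 1
  ext w
  rw [support_sub_sqfreeExponent, support_sub_sqfreeExponent]
  by_cases h : w = v
  · subst h
    simp only [Finset.mem_erase]
    split_ifs <;> omega
  · simp [h]

/-- If `Δ` contains all sets with fewer than `d` elements, Koszul homology of its Stanley-Reisner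
ring vanishes in homological degrees above `n - d + 1`. -/
theorem multigradedExact_of_skeleton {Δ : SimplicialComplex n} {d i : ℕ}
    (hΔ : ∀ F : Finset (Fin n), F.card < d → F ∈ Δ.faces) (hi : 1 ≤ i) (hid : n + 2 ≤ i + d)
    (a : Fin n →₀ ℕ) : MultigradedExact k Δ a i := by
  by_cases h2 : ∃ v, 2 ≤ a v
  · obtain ⟨v, hv⟩ := h2
    exact multigradedExact_of_two_le Δ i hv
  push Not at h2
  by_cases ha : a.support.Nonempty
  · obtain ⟨v, hv⟩ := ha
    -- In a squarefree multidegree, a set `T` with `i - 1` elements leaves fewer than `d` elements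
    -- for the support of `x^{a - T}`, so this monomial is nonzero in the ring and `(∂c)(T) = 0`.
    refine multigradedExact_of_cone v hv fun c hc hd S hS _ hvS => ?_
    by_cases hcard : S.card = i
    · refine hd _ ((Finset.erase_subset _ _).trans hS) (hΔ _ ?_)
      have hsub : (a - sqfreeExponent (S.erase v)).support ⊆ (S.erase v)ᶜ := by
        intro w hw
        rw [support_sub_sqfreeExponent] at hw
        rw [Finset.mem_compl]
        intro hwS
        rw [if_pos hwS] at hw
        have := h2 w
        omega
      have h1 := Finset.card_le_card hsub
      rw [Finset.card_compl, Fintype.card_fin] at h1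
      have h3 := Finset.card_erase_add_one hvS
      have h4 := card_finset_fin_le (S.erase v)
      omega
    · obtain ⟨j, rfl⟩ : ∃ j, i = j + 1 := ⟨i - 1, by omega⟩
      refine differential_card _ (fun S hS => hc S fun h => hS h.1) _ ?_
      have h3 := Finset.card_erase_add_one hvS
      omega
  · intro c hc _
    have hc0 : c = 0 := by
      funext S
      refine hc S ?_
      rintro ⟨h1, h3⟩
      rw [Finset.not_nonempty_iff_eq_empty.1 ha, Finset.subset_empty] at h3
      subst h3
      simp at h1
      omega
    subst hc0
    exact ⟨0, fun _ _ => rfl, fun _ _ _ => by rw [map_zero]⟩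

end Multigraded

/-! ### Alexander duality -/

section Duality

variable {n : ℕ} {k : Type u} [Field k]

/-- The sign `(-1)^{∑_{v ∈ F} v}`, which makes complementation intertwine the boundary map with its
transpose. -/
def complSign (F : Finset (Fin n)) : ℤ :=
  (-1) ^ ∑ v ∈ F, (v : ℕ)

theorem complSign_mul_self (F : Finset (Fin n)) : complSign F * complSign F = 1 := by
  rw [complSign, ← mul_pow]
  simp

/-- The elements below `v` in `T` and in the complement of `T` together number `v`. -/
theorem complSign_insert {v : Fin n} {T : Finset (Fin n)} (hv : v ∉ T) :
    complSign (insert v T) * koszulSign v (insert v T)ᶜ = complSign T * koszulSign v T := by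
  have hcard : (T.filter (· < v)).card + ((insert v T)ᶜ.filter (· < v)).card = (v : ℕ) := by
    rw [← Fin.card_Iio v, ← Finset.card_union_of_disjoint]
    · congr 1
      ext w
      simp only [Finset.mem_union, Finset.mem_filter, Finset.mem_compl, Finset.mem_insert,
        Finset.mem_Iio, not_or]
      constructor
      · rintro (h | h) <;> exact h.2
      · intro h
        by_cases hw : w ∈ T
        · exact Or.inl ⟨hw, h⟩
        · exact Or.inr ⟨⟨h.ne, hw⟩, h⟩
    · rw [Finset.disjoint_left]
      intro w hw hw'
      simp only [Finset.mem_filter, Finset.mem_compl, Finset.mem_insert, not_or] at hw hw'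
      exact hw'.1.2 hw.1
  have h : (-1 : ℤ) ^ (v : ℕ) * koszulSign v (insert v T)ᶜ = koszulSign v T := by
    rw [← hcard, pow_add, mul_assoc]
    change koszulSign v T * (koszulSign v (insert v T)ᶜ * koszulSign v (insert v T)ᶜ) = _
    rw [koszulSign_mul_self, mul_one]
  rw [complSign, Finset.sum_insert hv, add_comm, pow_add, mul_assoc, h, complSign]

/-- The pairing `∑_F ± c([n] \ F) f(F)`. -/
def complPairing (c f : Finset (Fin n) → k) : k :=
  ∑ F, complSign F • (c Fᶜ * f F)

/-- The boundary map is its own adjoint for the pairing by complements. -/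
theorem complPairing_boundary (c f : Finset (Fin n) → k) :
    complPairing (boundary k n c) f = complPairing c (boundary k n f) := by
  simp only [complPairing, boundary, differential_apply, one_smul, Finset.sum_mul, Finset.mul_sum,
    Finset.smul_sum, compl_compl]
  rw [Finset.sum_sigma', Finset.sum_sigma']
  refine Finset.sum_bij' (fun x _ => ⟨x.1.erase x.2, x.2⟩) (fun x _ => ⟨insert x.2 x.1, x.2⟩)
    ?_ ?_ ?_ ?_ ?_
  · rintro ⟨F, v⟩ _
    simp
  · rintro ⟨T, v⟩ _
    simp
  · rintro ⟨F, v⟩ h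
    simp only [Finset.mem_sigma, Finset.mem_univ, true_and] at h
    simp [Finset.insert_erase h]
  · rintro ⟨T, v⟩ h
    simp only [Finset.mem_sigma, Finset.mem_univ, Finset.mem_compl, true_and] at h
    simp [Finset.erase_insert h]
  · rintro ⟨F, v⟩ h
    simp only [Finset.mem_sigma, Finset.mem_univ, true_and] at h
    obtain ⟨T, hT, rfl⟩ : ∃ T, v ∉ T ∧ F = insert v T :=
      ⟨F.erase v, Finset.notMem_erase _ _, (Finset.insert_erase h).symm⟩
    have hc : insert v (insert v T)ᶜ = Tᶜ := by
      ext w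
      by_cases hw : w = v
      · simp [hw, hT]
      · simp [hw]
    simp only [Finset.erase_insert hT, hc]
    rw [smul_mul_assoc, smul_smul, complSign_insert hT, mul_smul_comm, smul_smul]

theorem complPairing_single_right (c : Finset (Fin n) → k) (F : Finset (Fin n)) :
    complPairing c (Pi.single F 1) = complSign F • c Fᶜ := by
  rw [complPairing, Finset.sum_eq_single F]
  · simp
  · intro G _ h
    simp [h]
  · simp

theorem complPairing_single_left (f : Finset (Fin n) → k) (F : Finset (Fin n)) :
    complPairing (Pi.single Fᶜ 1) f = complSign F • f F := by
  rw [complPairing, Finset.sum_eq_single F]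
  · simp
  · intro G _ h
    simp [h]
  · simp

theorem eq_sum_single (ℓ : (Finset (Fin n) → k) →ₗ[k] k) (x : Finset (Fin n) → k) :
    ℓ x = ∑ F, x F * ℓ (Pi.single F 1) := by
  conv_lhs => rw [← Finset.univ_sum_single x]
  rw [map_sum]
  refine Finset.sum_congr rfl fun F _ => ?_
  rw [← smul_eq_mul, ← map_smul, ← Pi.single_smul, smul_eq_mul, mul_one]

/-- The pairing is perfect on its second argument. -/
theorem exists_eq_complPairing_right (ℓ : (Finset (Fin n) → k) →ₗ[k] k) :
    ∃ c, ∀ f, ℓ f = complPairing c f := by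
  refine ⟨fun S => complSign Sᶜ • ℓ (Pi.single Sᶜ 1), fun f => ?_⟩
  rw [eq_sum_single, complPairing]
  refine Finset.sum_congr rfl fun F _ => ?_
  rw [compl_compl, smul_mul_assoc, smul_smul, complSign_mul_self, one_smul, mul_comm]

/-- The pairing is perfect on its first argument. -/
theorem exists_eq_complPairing_left (ℓ : (Finset (Fin n) → k) →ₗ[k] k) :
    ∃ f, ∀ c, ℓ c = complPairing c f := by
  refine ⟨fun S => complSign S • ℓ (Pi.single Sᶜ 1), fun c => ?_⟩
  rw [eq_sum_single, complPairing, ← Equiv.sum_comp (compl_involutive.toPerm _)]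
  refine Finset.sum_congr rfl fun F _ => ?_
  rw [mul_smul_comm, smul_smul, complSign_mul_self, one_smul]
  rfl

theorem boundary_eq_zero {c : Finset (Fin n) → k} {T : Finset (Fin n)}
    (h : ∀ v ∉ T, c (insert v T) = 0) : boundary k n c T = 0 := by
  rw [boundary, differential_apply]
  refine Finset.sum_eq_zero fun v hv => ?_
  rw [h v (Finset.mem_compl.1 hv), smul_zero, smul_zero]

/-- Vanishing of the reduced homology of `Δ` spanned by the faces with `p` elements. -/
def HomologyExact (k : Type u) [Field k] (Δ : SimplicialComplex n) (p : ℕ) : Prop :=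
  ∀ f : Finset (Fin n) → k, (∀ F, ¬ (F ∈ Δ.faces ∧ F.card = p) → f F = 0) → boundary k n f = 0 →
    ∃ g : Finset (Fin n) → k, (∀ F, ¬ (F ∈ Δ.faces ∧ F.card = p + 1) → g F = 0) ∧
      boundary k n g = f

theorem support_sqfreeExponent_univ_sub (S : Finset (Fin n)) :
    (sqfreeExponent Finset.univ - sqfreeExponent S).support = Sᶜ := by
  ext w
  rw [support_sub_sqfreeExponent, sqfreeExponent_apply, if_pos (Finset.mem_univ _),
    Finset.mem_compl]
  split_ifs with h <;> simp [h]

theorem subset_support_sqfreeExponent_univ (S : Finset (Fin n)) :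
    S ⊆ (sqfreeExponent (Finset.univ : Finset (Fin n))).support :=
  sqfreeExponent_le_iff.1 fun i => by
    rw [sqfreeExponent_apply, sqfreeExponent_apply]
    split_ifs <;> simp_all

/-- A relative cycle `c` that is not a relative boundary is separated from the relative boundaries
by some `f` under the pairing. Such an `f` is a cycle of `Δ`; were it a boundary, adjointness
would make it pair to zero with `c`. -/
theorem HomologyExact.multigradedExact {Δ : SimplicialComplex n} {i p : ℕ} (hip : i + p = n)
    (h : HomologyExact k Δ p) : MultigradedExact k Δ (sqfreeExponent Finset.univ) i := by
  intro c hc hd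
  have hcompl : ∀ F : Finset (Fin n), F.card + Fᶜ.card = n := fun F => by
    rw [Finset.card_add_card_compl, Fintype.card_fin]
  let W : Submodule k (Finset (Fin n) → k) :=
    { carrier := {x | ∃ e : Finset (Fin n) → k, (∀ S, S.card ≠ i + 1 → e S = 0) ∧
        ∀ S, Sᶜ ∈ Δ.faces → S.card = i → boundary k n e S = x S}
      zero_mem' := ⟨0, fun _ _ => rfl, fun S _ _ => by rw [map_zero]⟩
      add_mem' := by
        rintro x y ⟨e, he, hed⟩ ⟨e', he', hed'⟩
        exact ⟨e + e', fun S hS => by simp [he S hS, he' S hS],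
          fun S h1 h2 => by rw [map_add, Pi.add_apply, hed S h1 h2, hed' S h1 h2, Pi.add_apply]⟩
      smul_mem' := by
        rintro r x ⟨e, he, hed⟩
        exact ⟨r • e, fun S hS => by simp [he S hS],
          fun S h1 h2 => by rw [map_smul, Pi.smul_apply, hed S h1 h2, Pi.smul_apply]⟩ }
  have hcW : c ∈ W := by
    by_contra hcW
    obtain ⟨ℓ, hℓc, hℓW⟩ := Submodule.exists_le_ker_of_notMem hcW
    obtain ⟨f, hf⟩ := exists_eq_complPairing_left ℓ
    have hfval : ∀ F, f F = complSign F • ℓ (Pi.single Fᶜ 1) := fun F => by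
      rw [hf, complPairing_single_left, smul_smul, complSign_mul_self, one_smul]
    have hfW : ∀ x ∈ W, complPairing x f = 0 := fun x hx => by
      rw [← hf]
      exact hℓW hx
    obtain ⟨g, hg, hgd⟩ := h f
      (fun F hF => by
        rw [hfval, hf, hfW, smul_zero]
        refine ⟨0, fun _ _ => rfl, fun S h1 h2 => ?_⟩
        rw [map_zero, Pi.zero_apply, Pi.single_apply, if_neg]
        rintro rfl
        rw [compl_compl] at h1
        have := hcompl F
        exact hF ⟨h1, by omega⟩)
      (by
        funext T
        have h1 : complPairing (boundary k n (Pi.single Tᶜ 1)) f = 0 := hfW _ (by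
          by_cases hT : Tᶜ.card = i + 1
          · refine ⟨Pi.single Tᶜ 1, fun S hS => ?_, fun S _ _ => rfl⟩
            rw [Pi.single_apply, if_neg]
            rintro rfl
            exact hS hT
          · refine ⟨0, fun _ _ => rfl, fun S _ h2 => ?_⟩
            rw [map_zero]
            refine (boundary_eq_zero fun v hv => ?_).symm
            rw [Pi.single_apply, if_neg]
            intro h
            rw [← h, Finset.card_insert_of_notMem hv] at hT
            omega)
        rw [complPairing_boundary, complPairing_single_left] at h1
        have h2 := congrArg (complSign T • ·) h1
        simpa only [smul_smul, complSign_mul_self, one_smul, smul_zero, Pi.zero_apply] using h2)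
    apply hℓc
    rw [hf, ← hgd, ← complPairing_boundary, complPairing]
    refine Finset.sum_eq_zero fun F _ => ?_
    by_cases hF : F ∈ Δ.faces
    · rw [hd Fᶜ (subset_support_sqfreeExponent_univ _), zero_mul, smul_zero]
      rwa [support_sqfreeExponent_univ_sub, compl_compl]
    · rw [hg F fun h => hF h.1, mul_zero, smul_zero]
  obtain ⟨e, he, hed⟩ := hcW
  refine ⟨e, fun S hS => he S fun h => hS ⟨h, subset_support_sqfreeExponent_univ S⟩, ?_⟩
  intro S _ hS
  rw [support_sqfreeExponent_univ_sub] at hS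
  by_cases hSi : S.card = i
  · exact hed S hS hSi
  · rw [hc S fun h => hSi h.1]
    refine boundary_eq_zero fun v hv => he _ ?_
    rw [Finset.card_insert_of_notMem hv]
    omega

/-- A cycle `f` of `Δ` that is not a boundary is separated from the boundaries by some `c` under the
pairing. The part of `c` on `i`-element sets is a relative cycle; were it a relative boundary,
adjointness would make it pair to zero with `f`. -/
theorem MultigradedExact.homologyExact {Δ : SimplicialComplex n} {i p : ℕ} (hip : i + p = n)
    (h : MultigradedExact k Δ (sqfreeExponent Finset.univ) i) : HomologyExact k Δ p := by
  intro f hf hfd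
  have hcompl : ∀ F : Finset (Fin n), F.card + Fᶜ.card = n := fun F => by
    rw [Finset.card_add_card_compl, Fintype.card_fin]
  let W : Submodule k (Finset (Fin n) → k) :=
    (chains k Δ p).map (boundary k n)
  have hchains : ∀ g : Finset (Fin n) → k,
      g ∈ chains k Δ p ↔ ∀ F, ¬ (F ∈ Δ.faces ∧ F.card = p + 1) → g F = 0 := fun g => by
    change (∀ F, ¬ (F ∈ Δ.faces ∧ (F.card : ℤ) = p + 1) → g F = 0) ↔ _
    norm_cast
  suffices hfW : f ∈ W by
    obtain ⟨g, hg, hgd⟩ := hfW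
    exact ⟨g, (hchains g).1 hg, hgd⟩
  by_contra hfW
  obtain ⟨ℓ, hℓf, hℓW⟩ := Submodule.exists_le_ker_of_notMem hfW
  obtain ⟨c, hc⟩ := exists_eq_complPairing_right ℓ
  obtain ⟨e, -, hed⟩ := h (fun S => if S.card = i then c S else 0)
    (fun S hS => if_neg fun h => hS ⟨h, subset_support_sqfreeExponent_univ S⟩)
    (fun T _ hT => by
      rw [support_sqfreeExponent_univ_sub] at hT
      by_cases hTi : T.card + 1 = i
      · have h1 : boundary k n (fun S => if S.card = i then c S else 0) T = boundary k n c T := by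
          rw [boundary, differential_apply, differential_apply]
          refine Finset.sum_congr rfl fun v hv => ?_
          rw [if_pos (by rw [Finset.card_insert_of_notMem (Finset.mem_compl.1 hv), hTi])]
        have h2 : complPairing (boundary k n c) (Pi.single Tᶜ 1) = 0 := by
          rw [complPairing_boundary, ← hc]
          refine hℓW ⟨_, (hchains _).2 fun F hF => ?_, rfl⟩
          rw [Pi.single_apply, if_neg]
          rintro rfl
          have := hcompl T
          exact hF ⟨hT, by omega⟩
        rw [complPairing_single_right, compl_compl] at h2
        have h3 := congrArg (complSign Tᶜ • ·) h2
        rw [h1]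
        simpa only [smul_smul, complSign_mul_self, one_smul, smul_zero] using h3
      · refine boundary_eq_zero fun v hv => if_neg ?_
        rwa [Finset.card_insert_of_notMem hv])
  apply hℓf
  have h1 : complPairing c f = complPairing (boundary k n e) f := by
    refine Finset.sum_congr rfl fun F _ => ?_
    by_cases hF : F ∈ Δ.faces ∧ F.card = p
    · rw [hed Fᶜ (subset_support_sqfreeExponent_univ _), if_pos]
      · have := hcompl F
        omega
      · rw [support_sqfreeExponent_univ_sub, compl_compl]
        exact hF.1
    · rw [hf F hF, mul_zero, mul_zero]
  rw [hc, h1, complPairing_boundary, hfd]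
  exact Finset.sum_eq_zero fun F _ => by rw [Pi.zero_apply, mul_zero, smul_zero]

/-- Alexander duality in Hochster's form: the component of multidegree `(1, …, 1)` of the Koszul
complex of the Stanley-Reisner ring computes the reduced cohomology of `Δ`, which is dual to
reduced homology. -/
theorem multigradedExact_univ_iff {Δ : SimplicialComplex n} {i p : ℕ} (hip : i + p = n) :
    MultigradedExact k Δ (sqfreeExponent Finset.univ) i ↔ HomologyExact k Δ p :=
  ⟨fun h => h.homologyExact hip, fun h => h.multigradedExact hip⟩

theorem finrank_reducedHomology_eq_zero_iff {Δ : SimplicialComplex n} {i : ℤ} {p : ℕ}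
    (hip : i + 1 = p) :
    Module.finrank k (reducedHomology k Δ i) = 0 ↔ HomologyExact k Δ p := by
  obtain rfl : i = p - 1 := by omega
  have hchains : ∀ (q : ℕ) (j : ℤ), j + 1 = q → ∀ g : Finset (Fin n) → k,
      g ∈ chains k Δ j ↔ ∀ F, ¬ (F ∈ Δ.faces ∧ F.card = q) → g F = 0 := fun q j hj g => by
    change (∀ F, ¬ (F ∈ Δ.faces ∧ (F.card : ℤ) = j + 1) → g F = 0) ↔ _
    rw [hj]
    norm_cast
  rw [Module.finrank_zero_iff, Submodule.Quotient.subsingleton_iff, Submodule.submoduleOf_eq_top]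
  constructor
  · intro h f hf hfd
    obtain ⟨g, hg, hgd⟩ := h ⟨(hchains p _ hip f).2 hf, hfd⟩
    exact ⟨g, (hchains (p + 1) _ (by omega) g).1 hg, hgd⟩
  · rintro h f ⟨hf, hfd⟩
    obtain ⟨g, hg, hgd⟩ := h f ((hchains p _ hip f).1 hf) hfd
    exact ⟨g, (hchains (p + 1) _ (by omega) g).2 hg, hgd⟩

/-- Only `V = ∅` can make the connectivity zero. -/
theorem connectivity_eq_zero_iff {H : Hypergraph (Fin n)} {d : ℕ} (hd : 1 ≤ d) :
    connectivity k H d = 0 ↔ ¬ HomologyExact k (cliqueComplex H d) (d - 1) := by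
  have hres : (cliqueComplex H d).restrict (∅ : Finset (Fin n))ᶜ = cliqueComplex H d := by
    simp [SimplicialComplex.restrict]
  rw [← finrank_reducedHomology_eq_zero_iff (i := (d : ℤ) - 2) (by omega)]
  constructor
  · intro h h0
    have h1 : (1 : ℕ∞) ≤ connectivity k H d := by
      refine le_iInf₂ fun V hV => ?_
      rw [Nat.one_le_cast, Nat.one_le_iff_ne_zero, Finset.card_ne_zero,
        Finset.nonempty_iff_ne_empty]
      rintro rfl
      rw [Set.mem_ofPred_eq, hres] at hV
      exact hV h0
    rw [h] at h1
    exact absurd h1 (by simp)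
  · intro h
    have h1 : connectivity k H d ≤ ((∅ : Finset (Fin n)).card : ℕ∞) := by
      refine iInf₂_le _ ?_
      rw [Set.mem_ofPred_eq, hres]
      exact h
    simpa using h1

end Duality

/-! ### Krull dimension of Stanley-Reisner rings -/

section KrullDim

variable {n : ℕ} {k : Type u} [Field k]

/-- The map `k[x_1, …, x_n] → k[x_i : i ∈ F]` killing the variables outside `F`. -/
def restrictVars (k : Type u) [Field k] (F : Finset (Fin n)) :
    MvPolynomial (Fin n) k →ₐ[k] MvPolynomial F k :=
  aeval fun i => if h : i ∈ F then X ⟨i, h⟩ else 0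

theorem restrictVars_X (F : Finset (Fin n)) (i : Fin n) :
    restrictVars k F (X i) = if h : i ∈ F then X ⟨i, h⟩ else 0 :=
  aeval_X _ _

theorem restrictVars_surjective (F : Finset (Fin n)) :
    Function.Surjective (restrictVars k F) := by
  have h : (restrictVars k F).comp (rename Subtype.val) = AlgHom.id k _ := by
    ext1 i
    simp [restrictVars_X]
  exact fun p => ⟨rename Subtype.val p, AlgHom.congr_fun h p⟩

theorem ringKrullDim_mvPolynomial_finset (F : Finset (Fin n)) :
    ringKrullDim (MvPolynomial F k) = F.card := by
  rw [MvPolynomial.ringKrullDim_of_isNoetherianRing, ringKrullDim_eq_zero_of_field, zero_add]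
  simp

/-- A face `F` makes the polynomial ring in the variables of `F` a quotient of the Stanley-Reisner
ring. -/
theorem card_le_ringKrullDim {Δ : SimplicialComplex n} {F : Finset (Fin n)} (hF : F ∈ Δ.faces) :
    (F.card : WithBot ℕ∞) ≤ ringKrullDim (MvPolynomial (Fin n) k ⧸ stanleyReisnerIdeal k Δ) := by
  have hle : stanleyReisnerIdeal k Δ ≤ RingHom.ker (restrictVars k F).toRingHom := by
    rw [stanleyReisnerIdeal, Ideal.span_le]
    rintro _ ⟨G, hG, rfl⟩
    obtain ⟨i, hiG, hiF⟩ : ∃ i ∈ G, i ∉ F := by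
      by_contra! h
      exact hG (Δ.down_closed hF h)
    change restrictVars k F (∏ i ∈ G, X i) = 0
    rw [map_prod]
    refine Finset.prod_eq_zero hiG ?_
    rw [restrictVars_X, dif_neg hiF]
  rw [← ringKrullDim_mvPolynomial_finset (k := k) F]
  exact ringKrullDim_le_of_surjective
    (Ideal.Quotient.lift _ (restrictVars k F).toRingHom fun a ha => hle ha)
    (Ideal.Quotient.lift_surjective_of_surjective _ _ (restrictVars_surjective F))

/-- A prime containing the Stanley-Reisner ideal contains all variables outside some face, so its
coordinate ring is a quotient of a polynomial ring in at most `m` variables. -/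
theorem ringKrullDim_le_of_card_le {Δ : SimplicialComplex n} {m : ℕ}
    (hΔ : ∀ F ∈ Δ.faces, F.card ≤ m) :
    ringKrullDim (MvPolynomial (Fin n) k ⧸ stanleyReisnerIdeal k Δ) ≤ m := by
  classical
  rw [ringKrullDim_quotient]
  refine iSup_le fun p => ?_
  -- A chain of primes containing the ideal lives in the coordinate ring of its least member `P`.
  let P := p.head.1.asIdeal
  let F : Finset (Fin n) := Finset.univ.filter fun i => (X i : MvPolynomial (Fin n) k) ∉ P
  have hF : F ∈ Δ.faces := by
    by_contra h
    have h1 : (∏ i ∈ F, X i : MvPolynomial (Fin n) k) ∈ P :=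
      p.head.2 (Ideal.subset_span ⟨F, h, rfl⟩)
    obtain ⟨i, hi, hiP⟩ := (p.head.1.isPrime.prod_mem_iff).1 h1
    exact (Finset.mem_filter.1 hi).2 hiP
  have hdim : ringKrullDim (MvPolynomial (Fin n) k ⧸ P) ≤ F.card := by
    rw [← ringKrullDim_mvPolynomial_finset (k := k) F]
    let ψ : MvPolynomial F k →ₐ[k] MvPolynomial (Fin n) k ⧸ P :=
      aeval fun i => Ideal.Quotient.mk P (X i.1)
    have hψ : ψ.comp (restrictVars k F) = Ideal.Quotient.mkₐ k P := by
      ext1 i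
      rw [AlgHom.comp_apply, restrictVars_X]
      by_cases hi : i ∈ F
      · simp [hi, ψ]
      · rw [dif_neg hi, map_zero]
        refine (Ideal.Quotient.eq_zero_iff_mem.2 ?_).symm
        by_contra h
        exact hi (Finset.mem_filter.2 ⟨Finset.mem_univ _, h⟩)
    refine ringKrullDim_le_of_surjective ψ.toRingHom fun q => ?_
    obtain ⟨r, rfl⟩ := Ideal.Quotient.mk_surjective q
    exact ⟨restrictVars k F r, AlgHom.congr_fun hψ r⟩
  have hp : (p.length : WithBot ℕ∞) ≤ ringKrullDim (MvPolynomial (Fin n) k ⧸ P) := by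
    rw [ringKrullDim_quotient]
    let q : LTSeries (PrimeSpectrum.zeroLocus (R := MvPolynomial (Fin n) k) P) :=
      { length := p.length
        toFun := fun i => ⟨(p i).1, LTSeries.head_le p i⟩
        step := fun i => p.step i }
    exact Order.LTSeries.length_le_krullDim q
  exact (hp.trans hdim).trans (by exact_mod_cast hΔ F hF)

end KrullDim

/-! ### Depth, projective dimension and the linear strand -/

section Clique

variable {n : ℕ} {k : Type u} [Field k]

theorem mem_cliqueComplex_of_card_lt (H : Hypergraph (Fin n)) {d : ℕ} {F : Finset (Fin n)}
    (hF : F.card < d) : F ∈ (cliqueComplex H d).faces := by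
  intro E hE hc
  have := Finset.card_le_card hE
  omega

theorem irrelevantIdeal_eq_ker (k : Type u) [Field k] (n : ℕ) :
    irrelevantIdeal k n = RingHom.ker (constantCoeff : MvPolynomial (Fin n) k →+* k) := by
  ext p
  rw [RingHom.mem_ker, constantCoeff_eq]
  have h := mem_pow_idealOfVars_iff' 1 p
  rw [pow_one] at h
  refine h.trans ⟨fun h0 => h0 0 (by simp), fun h0 x hx => ?_⟩
  rw [Nat.lt_one_iff, Finsupp.degree_eq_zero_iff] at hx
  rw [hx, h0]

theorem irrelevantIdeal_isMaximal (k : Type u) [Field k] (n : ℕ) :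
    (irrelevantIdeal k n).IsMaximal := by
  rw [irrelevantIdeal_eq_ker]
  exact RingHom.ker_isMaximal_of_surjective _ fun c => ⟨C c, constantCoeff_C _ c⟩

theorem irrelevantIdeal_smul_top_ne_top {I : Ideal (MvPolynomial (Fin n) k)}
    (hI : I ≤ irrelevantIdeal k n) :
    irrelevantIdeal k n • (⊤ : Submodule (MvPolynomial (Fin n) k) (MvPolynomial (Fin n) k ⧸ I))
      ≠ ⊤ := by
  intro h
  rw [← Submodule.range_mkQ, ← Submodule.map_top, ← Submodule.map_smul'', smul_eq_mul,
    Ideal.mul_top] at h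
  obtain ⟨x, hx, hx1⟩ : I.mkQ 1 ∈ Submodule.map I.mkQ (irrelevantIdeal k n) := by
    rw [h]
    exact ⟨1, trivial, rfl⟩
  refine (irrelevantIdeal_isMaximal k n).ne_top ((Ideal.eq_top_iff_one _).2 ?_)
  have h1 : x - 1 ∈ irrelevantIdeal k n := hI ((Submodule.Quotient.eq _).1 hx1)
  have h2 := Ideal.sub_mem _ hx h1
  rwa [sub_sub_cancel] at h2

theorem stanleyReisnerIdeal_le {Δ : SimplicialComplex n} (hΔ : ∅ ∈ Δ.faces) :
    stanleyReisnerIdeal k Δ ≤ irrelevantIdeal k n := by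
  rw [stanleyReisnerIdeal, Ideal.span_le]
  rintro _ ⟨F, hF, rfl⟩
  obtain ⟨i, hi⟩ : F.Nonempty := by
    rw [Finset.nonempty_iff_ne_empty]
    rintro rfl
    exact hF hΔ
  exact Ideal.mem_of_dvd _ (Finset.dvd_prod_of_mem _ hi) (Ideal.subset_span ⟨i, rfl⟩)

/-- A complex containing all subsets of the vertex set is a simplex, hence acyclic. -/
theorem homologyExact_of_forall_mem {Δ : SimplicialComplex n} (hΔ : ∀ F, F ∈ Δ.faces) {p : ℕ}
    (hp : 1 ≤ p) : HomologyExact k Δ p := by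
  intro f hf hd
  have hf' : ∀ F, F.card ≠ p → f F = 0 := fun F hF => hf F fun h => hF h.2
  obtain rfl | hn := Nat.eq_zero_or_pos n
  · refine ⟨0, fun _ _ => rfl, ?_⟩
    funext S
    rw [map_zero, hf']
    · rfl
    · have := card_finset_fin_le S
      omega
  · refine ⟨cone ⟨0, hn⟩ f, fun F hF => cone_card _ hf' F fun h => hF ⟨hΔ F, h⟩, ?_⟩
    funext S
    rw [boundary_cone, hd, cone_zero]
    exact sub_zero _

theorem le_of_not_homologyExact {H : Hypergraph (Fin n)} {d : ℕ} (hd : 2 ≤ d)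
    (h : ¬ HomologyExact k (cliqueComplex H d) (d - 1)) : d ≤ n := by
  by_contra hn
  refine h (homologyExact_of_forall_mem (fun F => mem_cliqueComplex_of_card_lt H ?_) (by omega))
  have := card_finset_fin_le F
  omega

/-- Nonzero homology of `Δ(H)` in dimension `d - 2` is Koszul homology of `R/I` in homological
degree `n - d + 1` and multidegree `(1, …, 1)`. -/
theorem not_multigradedExact_univ {H : Hypergraph (Fin n)} {d : ℕ} (hd : 2 ≤ d)
    (h : ¬ HomologyExact k (cliqueComplex H d) (d - 1)) :
    ¬ MultigradedExact k (cliqueComplex H d) (sqfreeExponent Finset.univ) (n + 1 - d) := by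
  have := le_of_not_homologyExact hd h
  rwa [multigradedExact_univ_iff (p := d - 1) (by omega)]

theorem koszulExactAt_cliqueRing {H : Hypergraph (Fin n)} {d i : ℕ} (hi : 1 ≤ i)
    (hid : n + 2 ≤ i + d) :
    KoszulExactAt (cliqueRing k H d) (X : Fin n → MvPolynomial (Fin n) k) i :=
  koszulExactAt_of_multigradedExact
    (multigradedExact_of_skeleton (fun _ hF => mem_cliqueComplex_of_card_lt H hF) hi hid)

theorem projDim_cliqueRing {H : Hypergraph (Fin n)} {d : ℕ} (hd : 2 ≤ d)
    (h : ¬ HomologyExact k (cliqueComplex H d) (d - 1)) :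
    projDim k n (cliqueRing k H d) = ((n + 1 - d : ℕ) : WithBot ℕ∞) := by
  have hdn := le_of_not_homologyExact hd h
  refine le_antisymm (iSup₂_le fun i hi => ?_) ?_
  · rw [Set.mem_ofPred_eq, isZero_residueTor_iff] at hi
    have : i ≤ n + 1 - d := by
      by_contra hlt
      exact hi (koszulExactAt_cliqueRing (by omega) (by omega))
    exact_mod_cast this
  · refine le_iSup₂_of_le (n + 1 - d) ?_ le_rfl
    rw [Set.mem_ofPred_eq, isZero_residueTor_iff]
    exact fun h' => not_multigradedExact_univ hd h (h'.multigradedExact _)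

theorem linearStrandLength_cliqueRing {H : Hypergraph (Fin n)} {d : ℕ} (hd : 2 ≤ d)
    (h : ¬ HomologyExact k (cliqueComplex H d) (d - 1)) :
    linearStrandLength (stanleyReisnerIdeal k (cliqueComplex H d)) d =
      ((n + 1 - d : ℕ) : WithBot ℕ∞) := by
  have hdn := le_of_not_homologyExact hd h
  refine le_antisymm (iSup₂_le fun i hi => ?_) ?_
  · have : i ≤ n + 1 - d := by
      by_contra hlt
      exact hi (gradedBetti_eq_zero_of_multigradedExact fun a _ =>
        multigradedExact_of_skeleton (fun _ hF => mem_cliqueComplex_of_card_lt H hF)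
          (by omega) (by omega) a)
    exact_mod_cast this
  · refine le_iSup₂_of_le (n + 1 - d) ?_ le_rfl
    intro h'
    refine not_multigradedExact_univ hd h (multigradedExact_of_gradedBetti_eq_zero ?_)
    rw [degree_sqfreeExponent, Finset.card_univ, Fintype.card_fin]
    convert! h' using 2
    omega

theorem depth_cliqueRing {H : Hypergraph (Fin n)} {d : ℕ} (hd : 2 ≤ d)
    (h : ¬ HomologyExact k (cliqueComplex H d) (d - 1)) :
    depth k n (cliqueRing k H d) = ((d - 1 : ℕ) : ℕ∞) := by
  have hdn := le_of_not_homologyExact hd h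
  refine le_antisymm (iSup₂_le fun rs hrs => ?_) ?_
  · have := length_add_le_of_not_koszulExactAt (i := n + 1 - d) rs hrs.1 hrs.2
      fun h' => not_multigradedExact_univ hd h (h'.multigradedExact _)
    have hle : rs.length ≤ d - 1 := by omega
    exact_mod_cast hle
  · obtain ⟨rs, hrs, hreg, hlen⟩ := exists_isRegular_of_koszulExactAt
      (irrelevantIdeal_isMaximal k n) (d - 1) (M := cliqueRing k H d)
      (irrelevantIdeal_smul_top_ne_top
        (stanleyReisnerIdeal_le (mem_cliqueComplex_of_card_lt H (by simp; omega))))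
      (fun i hi => koszulExactAt_cliqueRing (by omega) (by omega))
    exact le_iSup₂_of_le rs ⟨hrs, hreg⟩ (by rw [hlen])

/-- In total degree `n` the only squarefree multidegree is `(1, …, 1)`. -/
theorem gradedBetti_eq_zero_of_homologyExact {Δ : SimplicialComplex n} {i p : ℕ}
    (hip : i + p = n) (h : HomologyExact k Δ p) :
    gradedBetti (stanleyReisnerIdeal k Δ) i n = 0 := by
  refine gradedBetti_eq_zero_of_multigradedExact fun a ha => ?_
  by_cases h2 : ∃ v, 2 ≤ a v
  · obtain ⟨v, hv⟩ := h2
    exact multigradedExact_of_two_le Δ i hv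
  push Not at h2
  have hle : ∀ v ∈ Finset.univ, a v ≤ 1 := fun v _ => Nat.lt_succ_iff.1 (h2 v)
  have hsum : ∑ v, a v = ∑ _v : Fin n, 1 := by
    rw [← Finsupp.degree_eq_sum, ha]
    simp
  have ha1 : a = sqfreeExponent Finset.univ := by
    ext v
    rw [(Finset.sum_eq_sum_iff_of_le hle).1 hsum v (Finset.mem_univ v), sqfreeExponent_apply,
      if_pos (Finset.mem_univ v)]
  rw [ha1]
  exact h.multigradedExact hip

/-- A linear strand of length exactly `n - d + 1` reaches total degree `n`. -/
theorem gradedBetti_ne_zero_of_linearStrandLength {I : Ideal (MvPolynomial (Fin n) k)} {d : ℕ}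
    (hd : 1 ≤ d) (h : linearStrandLength I d + (d : WithBot ℕ∞) = (n : WithBot ℕ∞) + 1) :
    ∃ i, i + (d - 1) = n ∧ gradedBetti I i n ≠ 0 := by
  -- Otherwise every term of the strand would have `i ≤ n - d`.
  by_contra! hno
  have hlt : ∀ i, gradedBetti I i (i + (d - 1)) ≠ 0 → i + d ≤ n := by
    intro i hi
    have h1 : (i : WithBot ℕ∞) ≤ linearStrandLength I d := le_iSup₂_of_le i hi le_rfl
    have h2 : (i : WithBot ℕ∞) + d ≤ n + 1 := h ▸ add_le_add_left h1 _
    have h3 : i + d ≤ n + 1 := by exact_mod_cast h2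
    by_contra h4
    have h5 : i + (d - 1) = n := by omega
    exact hi (h5.symm ▸ hno i h5)
  by_cases hdn : d ≤ n
  · have h1 : linearStrandLength I d ≤ ((n - d : ℕ) : WithBot ℕ∞) := by
      refine iSup₂_le fun i hi => ?_
      have := hlt i hi
      have h2 : i ≤ n - d := by omega
      exact_mod_cast h2
    have h2 : ((n - d : ℕ) : WithBot ℕ∞) + d ≥ n + 1 := h ▸ add_le_add_left h1 _
    have h3 : n + 1 ≤ n - d + d := by exact_mod_cast h2
    omega
  · have h1 : linearStrandLength I d = ⊥ := by
      rw [← le_bot_iff]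
      refine iSup₂_le fun i hi => ?_
      have := hlt i hi
      omega
    rw [h1, WithBot.bot_add] at h
    have h2 : ((n + 1 : ℕ) : WithBot ℕ∞) ≤ ⊥ := by
      rw [h]
      push_cast
      rfl
    exact absurd h2 (by simp)

/-- If no face has `d` vertices, the boundary of a `d`-element set is a cycle of `Δ(H)` that bounds
nothing. -/
theorem not_homologyExact_of_card_le {H : Hypergraph (Fin n)} {d : ℕ} (hd : 1 ≤ d)
    (hdn : d ≤ n) (hcard : ∀ F ∈ (cliqueComplex H d).faces, F.card ≤ d - 1) :
    ¬ HomologyExact k (cliqueComplex H d) (d - 1) := by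
  intro h
  obtain ⟨S, -, hS⟩ := Finset.exists_subset_card_eq
    (s := (Finset.univ : Finset (Fin n))) (n := d) (by simpa using hdn)
  have hsupp : ∀ F, F.card ≠ d - 1 + 1 → (Pi.single S 1 : Finset (Fin n) → k) F = 0 := by
    intro F hF
    rw [Pi.single_apply, if_neg]
    rintro rfl
    omega
  obtain ⟨g, hg, hgd⟩ := h (boundary k n (Pi.single S 1))
    (fun F hF => by
      by_cases hc : F.card = d - 1
      · exact absurd ⟨mem_cliqueComplex_of_card_lt H (by omega), hc⟩ hF
      · exact differential_card _ hsupp F hc)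
    (differential_differential _ _ _)
  have hg0 : g = 0 := by
    funext F
    refine hg F ?_
    rintro ⟨h1, h2⟩
    have := hcard F h1
    omega
  obtain ⟨v, hv⟩ : S.Nonempty := Finset.card_pos.1 (by omega)
  have h1 := congrFun hgd (S.erase v)
  rw [hg0, map_zero, boundary, differential_apply, Finset.sum_eq_single v] at h1
  · rw [Finset.insert_erase hv, Pi.single_eq_same, one_smul, Pi.zero_apply] at h1
    have h2 := congrArg (koszulSign v (S.erase v) • ·) h1
    simp only [smul_smul, koszulSign_mul_self, one_smul, smul_zero] at h2
    exact zero_ne_one h2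
  · intro w hw hwv
    rw [Pi.single_apply, if_neg, smul_zero, smul_zero]
    intro h
    have hwS : w ∈ S := h ▸ Finset.mem_insert_self _ _
    exact Finset.mem_compl.1 hw (Finset.mem_erase.2 ⟨hwv, hwS⟩)
  · intro h
    exact absurd (Finset.mem_compl.2 (Finset.notMem_erase v S)) h

theorem connectivity_ne_zero_of_isCohenMacaulay {H : Hypergraph (Fin n)} {d : ℕ} (hd : 2 ≤ d)
    (hCM : IsCohenMacaulay (stanleyReisnerIdeal k (cliqueComplex H d)))
    (hdim : (d : WithBot ℕ∞) ≤ ringKrullDim (cliqueRing k H d)) : connectivity k H d ≠ 0 := by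
  intro h
  rw [connectivity_eq_zero_iff (by omega)] at h
  rw [← show _ = ringKrullDim (cliqueRing k H d) from hCM, depth_cliqueRing hd h] at hdim
  have : d ≤ d - 1 := by exact_mod_cast hdim
  omega

end Clique

end HypergraphConn

end

theorem mainTheorem10 {k : Type*} [Field k] {n d : ℕ} (hd : 2 ≤ d) (H : Hypergraph (Fin n))
    (hV : H.vertexSet = Set.univ) (hH : HypergraphConn.IsUniform H d) :
    (¬ HypergraphConn.HomologicallyConnected k H d ↔
      HypergraphConn.projDim k n (HypergraphConn.cliqueRing k H d) + (d : WithBot ℕ∞) =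
          (n : WithBot ℕ∞) + 1 ∧
        HypergraphConn.depth k n (HypergraphConn.cliqueRing k H d) = ((d - 1 : ℕ) : ℕ∞) ∧
        HypergraphConn.LinearStrandMaximal
          (HypergraphConn.stanleyReisnerIdeal k (HypergraphConn.cliqueComplex H d)) d) ∧
    (HypergraphConn.IsCohenMacaulay
          (HypergraphConn.stanleyReisnerIdeal k (HypergraphConn.cliqueComplex H d)) →
      (d : WithBot ℕ∞) ≤ ringKrullDim (HypergraphConn.cliqueRing k H d) →
      HypergraphConn.connectivity k H d ≠ 0) ∧
    (HypergraphConn.connectivity k H d = 0 ∧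
        HypergraphConn.IsCohenMacaulay
          (HypergraphConn.stanleyReisnerIdeal k (HypergraphConn.cliqueComplex H d)) ↔
      H.edgeSet = ∅ ∧ d ≤ n) := by
  open HypergraphConn in
  refine ⟨?_, fun hCM hdim => connectivity_ne_zero_of_isCohenMacaulay hd hCM hdim, ?_, ?_⟩
  · rw [HomologicallyConnected, not_not, connectivity_eq_zero_iff (by omega)]
    constructor
    · intro h
      have hdn := le_of_not_homologyExact hd h
      refine ⟨?_, depth_cliqueRing hd h, ?_⟩
      · rw [projDim_cliqueRing hd h]
        have : n + 1 - d + d = n + 1 := by omega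
        exact_mod_cast this
      · rw [LinearStrandMaximal, linearStrandLength_cliqueRing hd h]
        exact (projDim_cliqueRing hd h).symm
    · rintro ⟨hpd, -, hlin⟩ h
      rw [← show linearStrandLength _ d = projDim k n (cliqueRing k H d) from hlin] at hpd
      obtain ⟨i, hi, hb⟩ := gradedBetti_ne_zero_of_linearStrandLength (by omega) hpd
      exact hb (gradedBetti_eq_zero_of_homologyExact hi h)
  · rintro ⟨hcon, hCM⟩
    refine ⟨?_, le_of_not_homologyExact hd ((connectivity_eq_zero_iff (by omega)).1 hcon)⟩
    by_contra hne
    obtain ⟨e, he⟩ := Set.nonempty_iff_ne_empty.2 hne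
    obtain ⟨F, rfl⟩ : ∃ F : Finset (Fin n), (F : Set (Fin n)) = e :=
      ⟨e.toFinite.toFinset, e.toFinite.coe_toFinset⟩
    have hFd : F.card = d := by
      rw [← Set.ncard_coe_finset]
      exact hH _ he
    have hF : F ∈ (cliqueComplex H d).faces := by
      intro E hE hc
      rwa [Finset.eq_of_subset_of_card_le hE (by omega)]
    have hdim := card_le_ringKrullDim (k := k) hF
    rw [hFd] at hdim
    exact connectivity_ne_zero_of_isCohenMacaulay hd hCM hdim hcon
  · rintro ⟨hE, hdn⟩
    have hcard : ∀ F ∈ (cliqueComplex H d).faces, F.card ≤ d - 1 := by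
      intro F hF
      by_contra hlt
      obtain ⟨E, hEF, hEd⟩ := Finset.exists_subset_card_eq (s := F) (n := d) (by omega)
      have := hF E hEF hEd
      rw [hE] at this
      exact this
    have h := not_homologyExact_of_card_le (k := k) (by omega) hdn hcard
    refine ⟨(connectivity_eq_zero_iff (by omega)).2 h, ?_⟩
    obtain ⟨S, -, hS⟩ := Finset.exists_subset_card_eq
      (s := (Finset.univ : Finset (Fin n))) (n := d - 1) (by simp; omega)
    have hge := card_le_ringKrullDim (k := k)
      (mem_cliqueComplex_of_card_lt H (d := d) (F := S) (by omega))
    rw [hS] at hge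
    rw [IsCohenMacaulay, show depth k n _ = _ from depth_cliqueRing hd h]
    exact le_antisymm hge (ringKrullDim_le_of_card_le hcard)
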